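/- **Setting.** Let $\mathcal S,\mathcal A$ be finite sets, $\rho$ a probability distribution on $\mathcal S$, $\pi_{\rm ref}$ a policy (a map $\mathcal S\to\Delta(\mathcal A)$) with full support, $R>0$, $\beta>0$ and $r^*:\mathcal S\times\mathcal A\to[0,R]$. For a reward $r$ put $\mathbb P_r(y=1|s,a,\tilde a)=\sigma(r(s,a)-r(s,\tilde a))$ with $\sigma(x)=1/(1+e^{-x})$, and for a policy $\pi$ put $\mathrm{KL}(\pi\|\pi_{\rm ref})=\mathbb E_{s\sim\rho,a\sim\pi(\cdot|s)}\log\frac{\pi(a|s)}{\pi_{\rm ref}(a|s)}$ and $J_\beta(\pi)=\mathbb E_{s\sim\rho,a\sim\pi}[r^*(s,a)]-\beta\,\mathrm{KL}(\pi\|\pi_{\rm ref})$. Let $\pi^*$ be a policy that maximizes $J_\beta$ over all policies. Let $\Pi$ be a finite class of policies with full support such that $\pi^*\in\Pi$ and $\max_{s,a}\left|\log\frac{\pi(a|s)}{\pi_{\rm ref}(a|s)}\right|\le R/\beta$ for all $\pi\in\Pi$; let $\mathrm{conv}(\Pi)$ be its convex hull. Let $\mathcal R^\Pi=\{r_{|\pi}:\pi\in\Pi\}$,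 where $r_{|\pi}(s,a)$ is $\beta\log\frac{\pi(a|s)}{\pi_{\rm ref}(a|s)}-\min_{a'}\beta\log\frac{\pi(a'|s)}{\pi_{\rm ref}(a'|s)}$ clipped to $[0,R]$. Let $\kappa(x)=\frac{(x-1)^2}{x-1-\log x}$. Let $\delta\in(0,1)$ and $T\ge1$. A dataset $\mathcal D=\{(s^t,a^t,\tilde a^t,y^t,\pi^t)\}_{t\le T}$ is collected sequentially: $\pi^t\in\mathrm{conv}(\Pi)$ is chosen, possibly at random, by an arbitrary online algorithm from the data of the earlier rounds, and then $s^t\sim\rho$, $a^t\sim\pi^t(\cdot|s^t)$, $\tilde a^t\sim\pi_{\rm ref}(\cdot|s^t)$, $y^t\sim\mathbb P_{r^*}(\cdot|s^t,a^t,\tilde a^t)$. With $$L_{\mathcal D}(r)=-\frac1T\sum_{t\le T}\Big(y^t\log\sigma(r(s^t,a^t)-r(s^t,\tilde a^t))+(1-y^t)\log\sigma(r(s^t,\tilde a^t)-r(s^t,a^t))\Big),$$ RPO returns any $$\pi_{\rm Dstl}\in\arg\max_{\pi\in\mathrm{conv}(\Pi)}\ \min_{r\in\mathcal R^\Pi}\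 L_{\mathcal D}(r)+\eta\Big(\mathbb E_{s\sim\rho,a\sim\pi,\tilde a\sim\pi_{\rm ref}}[r(s,a)-r(s,\tilde a)]-\beta\,\mathrm{KL}(\pi\|\pi_{\rm ref})\Big),\qquad \eta=(1+e^R)^{-2}\sqrt{\tfrac{24}{T}\log\tfrac{|\Pi|}{\delta}} .$$ **Corollary.** There are absolute constants $C,C'>0$, and for all $c_{\rm OL}>0$, $p_{\rm OL}\ge0$ there are $c>0$, $p\ge0$ depending only on $c_{\rm OL},p_{\rm OL}$, such that the following holds in every setting as above. Suppose that the online algorithm is no-regret: for a number $\mathcal C(\Pi)\ge0$ (a complexity measure), with probability at least $1-\delta$, $$\sum_{t=1}^T\big(J_\beta(\pi^*)-J_\beta(\pi^t)\big)\le c_{\rm OL}\,\mathcal C(\Pi)\sqrt T\,\log^{p_{\rm OL}}\tfrac{|\Pi|T}{\delta}.$$ Put $X=\beta^{-2}\mathcal C(\Pi)^2\kappa(e^{2R/\beta})^2$ and $T_0=c\,X\,\big(1+\log\frac{(1+X)|\Pi|}{\delta}\big)^{p}$. Then the argmax defining $\pi_{\rm Dstl}$ is nonempty, and: 1. If $T\ge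 T_0$, then with probability at least $1-2\delta$ every RPO output satisfies $$J_\beta(\pi^*)-J_\beta(\pi_{\rm Dstl})\le C\,e^{2R}\sqrt{\tfrac1T\log\tfrac{|\Pi|}{\delta}} .$$ 2. (Sample complexity.) For every $\varepsilon>0$ below the threshold given by $T_0\,\varepsilon^2\le C'e^{4R}\log\frac{|\Pi|}{\delta}$, if $T\ge C'e^{4R}\varepsilon^{-2}\log\frac{|\Pi|}{\delta}$, then with probability at least $1-2\delta$ every RPO output satisfies $J_\beta(\pi^*)-J_\beta(\pi_{\rm Dstl})\le\varepsilon$. This number of samples is $\tilde O(\varepsilon^{-2})$ and does not depend on $|\mathcal S|$, $|\mathcal A|$ or $\mathcal C(\Pi)$. -/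

import Mathlib

open MeasureTheory

noncomputable section

namespace RLHF

variable {S A : Type*} [Fintype S] [Fintype A]

/-- `π : S → A → ℝ` is a policy: `π s` is a probability vector on `A` for every state `s`. -/
def IsPolicy (π : S → A → ℝ) : Prop := ∀ s, π s ∈ stdSimplex ℝ A

/-- `E_{s ∼ ρ, a ∼ π(·|s)} [r(s,a)]`. -/
def expReward (ρ : S → ℝ) (π r : S → A → ℝ) : ℝ := ∑ s, ρ s * ∑ a, π s a * r s a

/-- `KL(π ‖ πref) = E_{s ∼ ρ, a ∼ π(·|s)} [log (π(a|s) / πref(a|s))]`, with `0 log 0 = 0`. -/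
def klReg (ρ : S → ℝ) (πref π : S → A → ℝ) : ℝ :=
  ∑ s, ρ s * ∑ a, π s a * Real.log (π s a / πref s a)

/-- The KL-regularized policy value `J_β(π)` with respect to the reward `r`. -/
def value (ρ : S → ℝ) (πref : S → A → ℝ) (β : ℝ) (r π : S → A → ℝ) : ℝ :=
  expReward ρ π r - β * klReg ρ πref π

/-- `π` maximizes `J_β` (for the reward `r`) among all policies. -/
def IsOptimalPolicy (ρ : S → ℝ) (πref : S → A → ℝ) (β : ℝ) (r π : S → A → ℝ) : Prop :=
  IsPolicy π ∧ ∀ π', IsPolicy π' → value ρ πref β r π' ≤ value ρ πref β r π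

/-- The function class assumption on a finite policy class `P`: it consists of policies, contains
the optimal policy, and every member has log-ratio to `πref` bounded by `R / β`
(in particular it has full support). -/
structure PolicyClassAssumption (πref : S → A → ℝ) (β R : ℝ) (πstar : S → A → ℝ)
    (P : Finset (S → A → ℝ)) : Prop where
  isPolicy : ∀ π ∈ P, IsPolicy π
  realizable : πstar ∈ P
  pos : ∀ π ∈ P, ∀ s a, 0 < π s a
  bounded_ratio : ∀ π ∈ P, ∀ s a, |Real.log (π s a / πref s a)| ≤ R / β

/-- The reward converted from a policy `π`:
`Clip_{[0,R]} [β log (π(a|s)/πref(a|s)) - min_{a'} β log (π(a'|s)/πref(a'|s))]`. -/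
def rewardOf (πref : S → A → ℝ) (β R : ℝ) (π : S → A → ℝ) : S → A → ℝ := fun s a =>
  max 0 (min R (β * Real.log (π s a / πref s a) - ⨅ a', β * Real.log (π s a' / πref s a')))

/-- The reward class converted from a policy class. -/
def rewardClass (πref : S → A → ℝ) (β R : ℝ) (P : Finset (S → A → ℝ)) : Set (S → A → ℝ) :=
  rewardOf πref β R '' (P : Set (S → A → ℝ))

/-- The Bradley-Terry preference probability `P_r(y | s, a, a')`, where `y = true` means that
`a` is preferred to `a'`. -/
def prefProb (r : S → A → ℝ) (s : S) (a a' : A) (y : Bool) : ℝ :=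
  if y then Real.sigmoid (r s a - r s a') else Real.sigmoid (r s a' - r s a)

/-- The average negative log-likelihood of the reward `r` on the data `(s, a, a', y)_{i < T}`. -/
def nll {T : ℕ} (D : Fin T → S × A × A × Bool) (r : S → A → ℝ) : ℝ :=
  (1 / (T : ℝ)) * ∑ i, -Real.log (prefProb r (D i).1 (D i).2.1 (D i).2.2.1 (D i).2.2.2)

/-- The RPO objective
`L_D(r) + η (E_{ρ,π}[r] - E_{ρ,πref}[r] - β KL(π ‖ πref))`. -/
def rpoObjective (ρ : S → ℝ) (πref : S → A → ℝ) (β η : ℝ) {T : ℕ}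
    (D : Fin T → S × A × A × Bool) (π r : S → A → ℝ) : ℝ :=
  nll D r + η * (expReward ρ π r - expReward ρ πref r - β * klReg ρ πref π)

/-- `π ∈ argmax_{π ∈ Q} min_{r ∈ 𝓡}` of the RPO objective. (For a finite nonempty class `𝓡`
the infimum is a minimum.) -/
def IsRPOSolution (ρ : S → ℝ) (πref : S → A → ℝ) (β η : ℝ) (Q 𝓡 : Set (S → A → ℝ)) {T : ℕ}
    (D : Fin T → S × A × A × Bool) (π : S → A → ℝ) : Prop :=
  π ∈ Q ∧ ∀ π' ∈ Q, sInf (rpoObjective ρ πref β η D π' '' 𝓡)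
    ≤ sInf (rpoObjective ρ πref β η D π '' 𝓡)

/-- The RPO weight `η = (1 + e^R)⁻² √((24 / T) log (|Π| / δ))`, where `N = |Π|`. -/
def rpoWeight (R δ : ℝ) (N T : ℕ) : ℝ :=
  ((1 + Real.exp R) ^ 2)⁻¹ * √(24 / T * Real.log (N / δ))

/-- The probability of `(s, a, a', y)` under `s ∼ ρ`, `a ∼ π(·|s)`, `a' ∼ πref(·|s)`,
`y ∼ P_r(· | s, a, a')`. -/
def sampleProb (ρ : S → ℝ) (πref r π : S → A → ℝ) (x : S × A × A × Bool) : ℝ :=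
  ρ x.1 * π x.1 x.2.1 * πref x.1 x.2.2.1 * prefProb r x.1 x.2.1 x.2.2.1 x.2.2.2

/-- The information available when round `i` is sampled: the samples of the rounds `j < i` and the
policies of the rounds `j ≤ i`. -/
@[reducible] def history {Ω : Type*} {T : ℕ} (pol : Fin T → Ω → S → A → ℝ)
    (D : Fin T → Ω → S × A × A × Bool) (i : Fin T) : MeasurableSpace Ω :=
  (⨆ j : {j : Fin T // j < i}, MeasurableSpace.comap (D j) ⊤) ⊔
    ⨆ j : {j : Fin T // j ≤ i}, MeasurableSpace.comap (pol j) inferInstance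

/-- The dataset is generated sequentially: in every round `i` a policy `pol i` is chosen from the
past (by an arbitrary, possibly randomized algorithm, so that nothing is imposed on the conditional
law of `pol i` given the past), and then, conditionally on the past and on `pol i`, the sample is
drawn from `ρ × pol i × πref × P_r`. -/
structure IsSequentialData {Ω : Type*} [MeasurableSpace Ω] (μ : Measure Ω) (ρ : S → ℝ)
    (πref r : S → A → ℝ) {T : ℕ} (pol : Fin T → Ω → S → A → ℝ)
    (D : Fin T → Ω → S × A × A × Bool) : Prop where
  measurable_pol : ∀ i, Measurable (pol i)
  measurable_data : ∀ i x, MeasurableSet {ω | D i ω = x}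
  cond_law : ∀ i x,
    μ[Set.indicator {ω | D i ω = x} (fun _ => (1 : ℝ)) | history pol D i]
      =ᵐ[μ] fun ω => sampleProb ρ πref r (pol i ω) x

/-- The event `p` holds with probability at least `1 - δ`: its complement has (outer) measure at
most `δ`. -/
def WithFailureProb {Ω : Type*} [MeasurableSpace Ω] (μ : Measure Ω) (δ : ℝ) (p : Ω → Prop) :
    Prop :=
  μ {ω | ¬ p ω} ≤ ENNReal.ofReal δ

/-- `κ(x) = (x - 1)² / (x - 1 - log x)`. -/
def kappa (x : ℝ) : ℝ := (x - 1) ^ 2 / (x - 1 - Real.log x)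

/-- `β⁻² C(Π)² κ(e^{2R/β})²`. -/
def burnIn (β R cplx : ℝ) : ℝ := β⁻¹ ^ 2 * cplx ^ 2 * kappa (Real.exp (2 * R / β)) ^ 2

/-- The burn-in time with its logarithmic factor: `c X (1 + log ((1 + X) |Π| / δ))^p`
with `X = β⁻² C(Π)² κ(e^{2R/β})²` and `N = |Π|`; it does not involve `T`. -/
def burnInLog (c p β R cplx δ : ℝ) (N : ℕ) : ℝ :=
  c * burnIn β R cplx * (1 + Real.log ((1 + burnIn β R cplx) * N / δ)) ^ p

end RLHF

end

/-! The optimal policy `π*` is the Gibbs policy of `r*` on the support of `ρ`, so the suboptimality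
of any policy is exactly `β KL(π ‖ π*)`. The integrand of this divergence is `x - 1 - log x` at `x =
π*/π`, and `κ` compares it with the `χ²` integrand `(x - 1)²`. As `π*/π^t ≤ e^{2R/β}`, small regret
forces the `π^t` to cover `π*`: after the burn-in the `χ²`-divergences sum to at most `T`, so a
change of measure from the data to `π*` costs a constant and the complexity `C(Π)` drops out.

The reward `r₀` converted from `π*` differs from `r*` by a function of the state, hence has the same
preferences and suboptimalities. Half the log-likelihood ratio of `r` to `r₀`, compensated by its
Bhattacharyya loss, is the logarithm of a supermartingale. Markov's inequality and a union bound
over `Π` (`measure_nll_sub_le`) bound `L(r₀) - L(r)` by `(2/T) log(|Π|/δ)` minus the curvature times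
the average squared gap between `r` and `r₀` under the data.

Comparing the RPO output with `π*` in the max-min (`IsRPOSolution.value_sub_le`) leaves `L(r₀) -
L(r)` plus `η` times a reward gap under `π*`. Change of measure and Young's inequality bound that
gap by the same squared gaps, which cancel. What remains is `η/(2α) + 2 log(|Π|/δ)/(Tη)`. -/

namespace RLHF

/-! ### Scalar inequalities: Bernoulli laws and the sigmoid -/

/-- The Bhattacharyya coefficient of two Bernoulli laws is at most `1 - (p - q)² / 2`. -/
theorem sqrt_mul_add_sqrt_mul_le {p q : ℝ} (hp0 : 0 ≤ p) (hp1 : p ≤ 1) (hq0 : 0 ≤ q)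
    (hq1 : q ≤ 1) : √(p * q) + √((1 - p) * (1 - q)) ≤ 1 - (p - q) ^ 2 / 2 := by
  have hp1' : 0 ≤ 1 - p := by linarith
  have hq1' : 0 ≤ 1 - q := by linarith
  rw [Real.sqrt_mul hp0, Real.sqrt_mul hp1']
  have e1 := Real.sq_sqrt hp0
  have e2 := Real.sq_sqrt hq0
  have e3 := Real.sq_sqrt hp1'
  have e4 := Real.sq_sqrt hq1'
  set u := √p
  set v := √q
  set u' := √(1 - p)
  set v' := √(1 - q)
  have hx : (p - q) ^ 2 = (u - v) ^ 2 * (u + v) ^ 2 := by rw [← e1, ← e2]; ring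
  have hy : (p - q) ^ 2 = (u' - v') ^ 2 * (u' + v') ^ 2 := by
    have : p - q = v' ^ 2 - u' ^ 2 := by rw [e3, e4]; ring
    rw [this]; ring
  have hα : 0 ≤ (u - v) ^ 2 := sq_nonneg _
  have hβ : 0 ≤ (u' - v') ^ 2 := sq_nonneg _
  have hsum : 2 - 2 * (u * v + u' * v') = (u - v) ^ 2 + (u' - v') ^ 2 := by
    linear_combination (-1) * e1 - e2 - e3 - e4
  have hsum' : (u + v) ^ 2 + (u' + v') ^ 2 = 4 - ((u - v) ^ 2 + (u' - v') ^ 2) := by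
    linear_combination 2 * e1 + 2 * e2 + 2 * e3 + 2 * e4
  suffices h : (p - q) ^ 2 ≤ (u - v) ^ 2 + (u' - v') ^ 2 by linarith
  set α := (u - v) ^ 2
  set b := (u' - v') ^ 2
  rcases eq_or_lt_of_le (add_nonneg hα hβ) with h0 | h0
  · have : α = 0 := by linarith
    rw [hx, this]; simp; linarith
  · have h1 : (p - q) ^ 2 * (α + b) ≤ (α + b) * (α + b) := by
      -- Weighting the factorizations `hx` and `hy` by `b` and `α` gives a product below `4 α b`,
      -- and `4 α b ≤ (α + b)²`.
      have : (p - q) ^ 2 * (α + b) = α * b * (4 - (α + b)) := by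
        rw [← hsum']; linear_combination b * hx + α * hy
      rw [this]
      nlinarith [sq_nonneg (α - b), mul_nonneg (mul_nonneg hα hβ) h0.le]
    exact le_of_mul_le_mul_right h1 h0

theorem exp_add_exp_neg_le {x R : ℝ} (hx : |x| ≤ R) :
    Real.exp x + Real.exp (-x) ≤ Real.exp R + Real.exp (-R) := by
  have h := Real.cosh_le_cosh.2 (hx.trans (le_abs_self R))
  rw [Real.cosh_eq, Real.cosh_eq] at h
  linarith

/-- The product equals `(2 + 2 cosh x)⁻¹`, which on `[-R, R]` is smallest at the endpoints. -/
theorem le_sigmoid_mul_one_sub {x R : ℝ} (hx : |x| ≤ R) :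
    Real.exp R / (1 + Real.exp R) ^ 2 ≤ Real.sigmoid x * (1 - Real.sigmoid x) := by
  have h := exp_add_exp_neg_le hx
  have key : ∀ y : ℝ, Real.exp y / (1 + Real.exp y) ^ 2 = (2 + (Real.exp y + Real.exp (-y)))⁻¹ := by
    intro y
    rw [Real.exp_neg]
    have := Real.exp_pos y
    field_simp
    ring
  have e : Real.sigmoid x * (1 - Real.sigmoid x) = Real.exp x / (1 + Real.exp x) ^ 2 := by
    rw [Real.sigmoid_def, Real.exp_neg]
    have := Real.exp_pos x
    field_simp
    ring
  rw [e, key, key]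
  have := Real.exp_pos x
  have := Real.exp_pos (-x)
  gcongr

/-- The sigmoid function is strongly increasing on `[-R, R]`. -/
theorem mul_sub_sq_le_sigmoid_sub_sq {x y R : ℝ} (hx : |x| ≤ R) (hy : |y| ≤ R) :
    (Real.exp R / (1 + Real.exp R) ^ 2) ^ 2 * (x - y) ^ 2
      ≤ (Real.sigmoid x - Real.sigmoid y) ^ 2 := by
  have main : ∀ x y : ℝ, |x| ≤ R → |y| ≤ R → x ≤ y →
      Real.exp R / (1 + Real.exp R) ^ 2 * (y - x) ≤ Real.sigmoid y - Real.sigmoid x := by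
    intro x y hx hy hxy
    refine Convex.mul_sub_le_image_sub_of_le_deriv (D := Set.Icc (-R) R) (convex_Icc _ _)
      continuous_sigmoid.continuousOn differentiable_sigmoid.differentiableOn
      ?_ x (abs_le.1 hx) y (abs_le.1 hy) hxy
    intro z hz
    rw [Real.deriv_sigmoid]
    exact le_sigmoid_mul_one_sub (abs_le.2 (interior_subset hz : z ∈ Set.Icc (-R) R))
  have hc : 0 ≤ Real.exp R / (1 + Real.exp R) ^ 2 := by positivity
  rw [← mul_pow]
  rcases le_total x y with h | h
  · have h1 := main x y hx hy h
    have : 0 ≤ Real.exp R / (1 + Real.exp R) ^ 2 * (y - x) := mul_nonneg hc (by linarith)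
    nlinarith
  · have h1 := main y x hy hx h
    have : 0 ≤ Real.exp R / (1 + Real.exp R) ^ 2 * (x - y) := mul_nonneg hc (by linarith)
    nlinarith

/-! ### The function `κ` and the inversion of the burn-in condition -/

theorem sub_one_sub_log_pos {x : ℝ} (hx : 0 < x) (h1 : x ≠ 1) : 0 < x - 1 - Real.log x := by
  have := Real.log_lt_sub_one_of_pos hx h1
  linarith

theorem kappa_pos {M : ℝ} (hM : 1 < M) : 0 < kappa M :=
  div_pos (pow_pos (by linarith) 2) (sub_one_sub_log_pos (by linarith) hM.ne')

/-- The bound `κ(x) ≤ k` means that this gap is nonnegative. For `k > 0` its derivative can change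
sign on `x > 0` only at `1` and `k / 2`. -/
theorem hasDerivAt_kappa_gap (k : ℝ) {x : ℝ} (hx : 0 < x) :
    HasDerivAt (fun x => k * (x - 1 - Real.log x) - (x - 1) ^ 2) ((x - 1) * (k / x - 2)) x := by
  have h1 : HasDerivAt (fun x : ℝ => x - 1) 1 x := (hasDerivAt_id x).sub_const 1
  have := ((h1.sub (Real.hasDerivAt_log hx.ne')).const_mul k).sub (h1.pow 2)
  refine this.congr_deriv ?_
  push_cast
  field_simp

/-- For `k = 2` the gap is nonincreasing on `[1, ∞)` and vanishes at `1`. The bound places the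
critical point `k / 2` to the right of `1`. -/
theorem two_le_kappa {M : ℝ} (hM : 1 < M) : 2 ≤ kappa M := by
  have hM0 : 0 < M := by linarith
  rw [kappa, le_div_iff₀ (sub_one_sub_log_pos hM0 hM.ne')]
  have h : AntitoneOn (fun x : ℝ => 2 * (x - 1 - Real.log x) - (x - 1) ^ 2) (Set.Ici 1) := by
    refine antitoneOn_of_deriv_nonpos (convex_Ici 1) ?_ ?_ ?_
    · intro x hx
      exact (hasDerivAt_kappa_gap 2 (lt_of_lt_of_le one_pos hx)).continuousAt.continuousWithinAt
    · intro x hx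
      rw [interior_Ici] at hx
      exact (hasDerivAt_kappa_gap 2
        (one_pos.trans hx)).differentiableAt.differentiableWithinAt
    · intro x hx
      rw [interior_Ici] at hx
      have hx' : (1 : ℝ) < x := hx
      rw [(hasDerivAt_kappa_gap 2 (one_pos.trans hx')).deriv]
      refine mul_nonpos_of_nonneg_of_nonpos (by linarith) ?_
      rw [sub_nonpos, div_le_iff₀ (one_pos.trans hx')]
      linarith
  have := h (Set.mem_Ici.2 le_rfl) (Set.mem_Ici.2 hM.le) hM.le
  simp at this
  linarith

/-- The function `κ` is nondecreasing: it bounds the ratio of `χ²` to `KL` integrands. -/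
theorem sub_one_sq_le_kappa_mul {M x : ℝ} (hM : 1 < M) (hx : 0 < x) (hxM : x ≤ M) :
    (x - 1) ^ 2 ≤ kappa M * (x - 1 - Real.log x) := by
  have hM0 : 0 < M := by linarith
  set k := kappa M with hk
  have hk2 : 2 ≤ k := two_le_kappa hM
  have hM' : k * (M - 1 - Real.log M) - (M - 1) ^ 2 = 0 := by
    rw [hk, kappa, div_mul_cancel₀ _ (sub_one_sub_log_pos hM0 hM.ne').ne', sub_self]
  set F : ℝ → ℝ := fun x => k * (x - 1 - Real.log x) - (x - 1) ^ 2 with hF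
  have hF1 : F 1 = 0 := by simp [hF]
  have hcont : ∀ x : ℝ, 0 < x → ContinuousAt F x := fun x hx =>
    (hasDerivAt_kappa_gap k hx).continuousAt
  have hdiff : ∀ x : ℝ, 0 < x → DifferentiableAt ℝ F x := fun x hx =>
    (hasDerivAt_kappa_gap k hx).differentiableAt
  suffices h : 0 ≤ F x by simp only [hF] at h; linarith
  -- `F` falls up to `1`, rises up to `k / 2` and falls afterwards. It vanishes at `1` and, by the
  -- choice of `k`, at `M`, so it is nonnegative on `(0, M]`.
  rcases le_total x 1 with h1 | h1
  · have h : AntitoneOn F (Set.Ioc 0 1) := by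
      refine antitoneOn_of_deriv_nonpos (convex_Ioc 0 1)
        (fun y hy => (hcont y hy.1).continuousWithinAt)
        (fun y hy => (hdiff y (interior_subset hy).1).differentiableWithinAt) ?_
      intro y hy
      have hy' := interior_subset hy
      rw [(hasDerivAt_kappa_gap k hy'.1).deriv]
      refine mul_nonpos_of_nonpos_of_nonneg (by linarith [hy'.2]) ?_
      rw [sub_nonneg, le_div_iff₀ hy'.1]
      linarith [hy'.2]
    have := h ⟨hx, h1⟩ ⟨one_pos, le_rfl⟩ h1
    linarith
  · rcases le_total x (k / 2) with h2 | h2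
    · have h : MonotoneOn F (Set.Icc 1 (k / 2)) := by
        refine monotoneOn_of_deriv_nonneg (convex_Icc _ _)
          (fun y hy => (hcont y (by linarith [hy.1])).continuousWithinAt)
          (fun y hy => (hdiff y (by linarith [(interior_subset hy).1])).differentiableWithinAt) ?_
        intro y hy
        have hy' := interior_subset hy
        have hy0 : 0 < y := by linarith [hy'.1]
        rw [(hasDerivAt_kappa_gap k hy0).deriv]
        refine mul_nonneg (by linarith [hy'.1]) ?_
        rw [sub_nonneg, le_div_iff₀ hy0]
        linarith [hy'.2]
      have := h ⟨le_rfl, by linarith⟩ ⟨h1, h2⟩ h1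
      linarith
    · have h : AntitoneOn F (Set.Ici (k / 2)) := by
        refine antitoneOn_of_deriv_nonpos (convex_Ici _)
          (fun y hy => (hcont y (by linarith [Set.mem_Ici.1 hy])).continuousWithinAt)
          (fun y hy => (hdiff y
            (by linarith [Set.mem_Ici.1 (interior_subset hy)])).differentiableWithinAt) ?_
        intro y hy
        have hy' := Set.mem_Ici.1 (interior_subset hy)
        have hy0 : 0 < y := by linarith
        rw [(hasDerivAt_kappa_gap k hy0).deriv]
        refine mul_nonpos_of_nonneg_of_nonpos (by linarith) ?_
        rw [sub_nonpos, div_le_iff₀ hy0]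
        linarith
      have := h h2 (h2.trans hxM) hxM
      have hFM : F M = 0 := hM'
      linarith

theorem exists_mul_log_rpow_le (c q : ℝ) (hq : 0 ≤ q) :
    ∃ c₀ : ℝ, 1 ≤ c₀ ∧ ∀ u : ℝ, c₀ ≤ u → c * (2 + q + Real.log u) ^ q ≤ u := by
  have h1 : (fun x : ℝ => c * (2 + q + Real.log x) ^ q) =o[Filter.atTop] fun x => x := by
    refine Asymptotics.IsLittleO.const_mul_left ?_ c
    have h2 : (fun x : ℝ => (2 + q + Real.log x) ^ q) =O[Filter.atTop]
        fun x => (Real.log x) ^ q := by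
      refine Asymptotics.IsBigO.of_bound ((3 + q) ^ q) ?_
      filter_upwards [Filter.eventually_ge_atTop (Real.exp 1)] with x hx
      have hl : 1 ≤ Real.log x := by
        rw [Real.le_log_iff_exp_le (lt_of_lt_of_le (Real.exp_pos 1) hx)]; exact hx
      have hl0 : 0 ≤ Real.log x := by linarith
      rw [Real.norm_of_nonneg (by positivity), Real.norm_of_nonneg (by positivity),
        ← Real.mul_rpow (by positivity) hl0]
      refine Real.rpow_le_rpow (by positivity) ?_ hq
      nlinarith
    have h3 := h2.trans_isLittleO (isLittleO_log_rpow_rpow_atTop q one_pos)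
    simpa using h3
  have h2 := h1.bound one_pos
  obtain ⟨c₀, hc₀⟩ := Filter.eventually_atTop.1 (h2.and (Filter.eventually_ge_atTop 1))
  refine ⟨max c₀ 1, le_max_right _ _, fun u hu => ?_⟩
  obtain ⟨h3, h4⟩ := hc₀ u ((le_max_left _ _).trans hu)
  rw [one_mul, Real.norm_of_nonneg (by linarith : (0 : ℝ) ≤ u)] at h3
  exact (le_abs_self _).trans h3

/-- Inversion of `T ≥ c X log^q T`: the logarithm of `T` can be traded for that of `X`. -/
theorem exists_burnIn_inversion (c q : ℝ) (hc : 0 < c) (hq : 0 ≤ q) :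
    ∃ c₀ : ℝ, 0 < c₀ ∧ ∀ X M T : ℝ, 0 ≤ X → 1 ≤ M → 1 ≤ T →
      c₀ * X * (1 + Real.log ((1 + X) * M)) ^ q ≤ T →
      c * X * Real.log (M * T) ^ q ≤ T := by
  obtain ⟨c₀, hc₀, H⟩ := exists_mul_log_rpow_le c q hq
  refine ⟨c₀, by linarith, fun X M T hX hM hT h => ?_⟩
  rcases hX.eq_or_lt with rfl | hX
  · simp; linarith
  have hT0 : 0 < T := by linarith
  have hM0 : 0 < M := by linarith
  have hlM := Real.log_nonneg hM
  have hlX : 0 ≤ Real.log (1 + X) := Real.log_nonneg (by linarith)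
  have hlT := Real.log_nonneg hT
  rw [Real.log_mul (by linarith) hM0.ne'] at h
  rw [Real.log_mul hM0.ne' hT0.ne']
  set Λ := 1 + (Real.log (1 + X) + Real.log M) with hΛ
  have hΛ1 : 1 ≤ Λ := by linarith
  have hΛ0 : 0 < Λ := by linarith
  have hΛq : 0 < Λ ^ q := Real.rpow_pos_of_pos hΛ0 q
  -- With `T = u X Λ^q`, `log (M T)` is at most `Λ (2 + q + log u)`. The factor `Λ^q` is already
  -- part of `T`, and `u` outgrows the remaining power of its own logarithm.
  set u := T / (X * Λ ^ q) with hu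
  have hXΛ : 0 < X * Λ ^ q := mul_pos hX hΛq
  have hcu : c₀ ≤ u := by
    rw [hu, le_div_iff₀ hXΛ]; linarith
  have hu1 : 1 ≤ u := hc₀.trans hcu
  have hlu := Real.log_nonneg hu1
  have hTu : T = u * (X * Λ ^ q) := by rw [hu, div_mul_cancel₀ _ hXΛ.ne']
  have hlogT : Real.log T = Real.log u + (Real.log X + q * Real.log Λ) := by
    rw [hTu, Real.log_mul (by linarith) hXΛ.ne', Real.log_mul hX.ne' hΛq.ne',
      Real.log_rpow hΛ0]
  have h1 : Real.log X ≤ Real.log (1 + X) := Real.log_le_log hX (by linarith)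
  have h2 : Real.log Λ ≤ Λ := by linarith [Real.log_le_sub_one_of_pos hΛ0]
  have h3 : Real.log M + Real.log T ≤ Λ * (2 + q + Real.log u) := by
    nlinarith [mul_le_mul_of_nonneg_left h2 hq, mul_nonneg (sub_nonneg.2 hΛ1) hlu]
  have h4 : (Real.log M + Real.log T) ^ q ≤ Λ ^ q * (2 + q + Real.log u) ^ q := by
    rw [← Real.mul_rpow hΛ0.le (by positivity)]
    exact Real.rpow_le_rpow (by positivity) h3 hq
  calc c * X * (Real.log M + Real.log T) ^ q
      ≤ c * X * (Λ ^ q * (2 + q + Real.log u) ^ q) := by gcongr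
    _ = (c * (2 + q + Real.log u) ^ q) * (X * Λ ^ q) := by ring
    _ ≤ u * (X * Λ ^ q) := mul_le_mul_of_nonneg_right (H u hcu) hXΛ.le
    _ = T := hTu.symm

end RLHF

/-! ### Policies, the Gibbs form of the optimum, `KL` and `χ²` -/

namespace RLHF

section

variable {S A : Type*}

theorem rewardOf_mem_Icc (πref : S → A → ℝ) (β : ℝ) {R : ℝ} (hR : 0 ≤ R) (π : S → A → ℝ)
    (s : S) (a : A) : rewardOf πref β R π s a ∈ Set.Icc 0 R :=
  ⟨le_max_left _ _, max_le hR (min_le_left _ _)⟩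

theorem le_of_mem_convexHull {P : Set (S → A → ℝ)} {f : S → A → ℝ}
    (hP : ∀ π ∈ P, ∀ s a, f s a ≤ π s a) {π : S → A → ℝ} (hπ : π ∈ convexHull ℝ P) (s : S) (a : A) :
    f s a ≤ π s a := by
  have : π ∈ Set.Ici f :=
    convexHull_min (fun π h => fun s a => hP π h s a) (convex_Ici f) hπ
  exact this s a

variable [Fintype A]

/-- Clipping is inactive when the log-ratio has oscillation at most `R`. -/
theorem rewardOf_eq_sub_iInf {πref π : S → A → ℝ} {β R : ℝ} {s : S}
    (h : ∀ a a', β * Real.log (π s a / πref s a) - β * Real.log (π s a' / πref s a') ≤ R) (a : A) :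
    rewardOf πref β R π s a
      = β * Real.log (π s a / πref s a) + -⨅ a', β * Real.log (π s a' / πref s a') := by
  have : Nonempty A := ⟨a⟩
  have h1 : ⨅ a', β * Real.log (π s a' / πref s a') ≤ β * Real.log (π s a / πref s a) :=
    ciInf_le (Set.finite_range _).bddBelow a
  have h2 : β * Real.log (π s a / πref s a) - R ≤ ⨅ a', β * Real.log (π s a' / πref s a') :=
    le_ciInf fun a' => by linarith [h a a']
  rw [rewardOf, min_eq_right (by linarith), max_eq_right (by linarith), sub_eq_add_neg]

theorem IsPolicy.convexHull {P : Set (S → A → ℝ)} (hP : ∀ π ∈ P, IsPolicy π) {π : S → A → ℝ}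
    (hπ : π ∈ convexHull ℝ P) : IsPolicy π := by
  have hconv : Convex ℝ {π : S → A → ℝ | IsPolicy π} :=
    fun x hx y hy a b ha hb hab s => convex_stdSimplex ℝ A (hx s) (hy s) ha hb hab
  exact convexHull_min (fun π h => hP π h) hconv hπ

theorem nonempty_of_isPolicy {π : S → A → ℝ} (hπ : IsPolicy π) (s : S) : Nonempty A := by
  by_contra h
  rw [not_nonempty_iff] at h
  have := (hπ s).2
  simp at this

/-- The policy that is optimal for the reward `r` at every state. -/
noncomputable def gibbs (πref r : S → A → ℝ) (β : ℝ) : S → A → ℝ := fun s a =>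
  πref s a * Real.exp (r s a / β) / ∑ a', πref s a' * Real.exp (r s a' / β)

theorem gibbs_normalizer_pos {πref : S → A → ℝ} (href : IsPolicy πref)
    (hpos : ∀ s a, 0 < πref s a) (r : S → A → ℝ) (β : ℝ) (s : S) :
    0 < ∑ a', πref s a' * Real.exp (r s a' / β) :=
  have := nonempty_of_isPolicy href s
  Finset.sum_pos (fun a _ => mul_pos (hpos s a) (Real.exp_pos _)) Finset.univ_nonempty

theorem gibbs_pos {πref : S → A → ℝ} (href : IsPolicy πref) (hpos : ∀ s a, 0 < πref s a)
    (r : S → A → ℝ) (β : ℝ) (s : S) (a : A) : 0 < gibbs πref r β s a :=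
  div_pos (mul_pos (hpos s a) (Real.exp_pos _)) (gibbs_normalizer_pos href hpos r β s)

theorem isPolicy_gibbs {πref : S → A → ℝ} (href : IsPolicy πref) (hpos : ∀ s a, 0 < πref s a)
    (r : S → A → ℝ) (β : ℝ) : IsPolicy (gibbs πref r β) := fun s =>
  ⟨fun a => (gibbs_pos href hpos r β s a).le, by
    simp only [gibbs]
    rw [← Finset.sum_div, div_self (gibbs_normalizer_pos href hpos r β s).ne']⟩

theorem reward_eq_log_gibbs {πref : S → A → ℝ} (href : IsPolicy πref)
    (hpos : ∀ s a, 0 < πref s a) (r : S → A → ℝ) {β : ℝ} (hβ : 0 < β) (s : S) (a : A) :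
    r s a = β * Real.log (gibbs πref r β s a / πref s a)
      + β * Real.log (∑ a', πref s a' * Real.exp (r s a' / β)) := by
  have hZ := gibbs_normalizer_pos href hpos r β s
  have h1 : gibbs πref r β s a / πref s a
      = Real.exp (r s a / β) / ∑ a', πref s a' * Real.exp (r s a' / β) := by
    have := (hpos s a).ne'
    simp only [gibbs]
    field_simp
  rw [h1, Real.log_div (Real.exp_pos _).ne' hZ.ne', Real.log_exp]
  field_simp
  ring

end

variable {S A : Type*} [Fintype S] [Fintype A]

theorem klReg_self (ρ : S → ℝ) {g : S → A → ℝ} (hg : ∀ s a, 0 < g s a) : klReg ρ g g = 0 := by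
  simp [klReg, fun s a => div_self (hg s a).ne']

/-- If the reward is a log-ratio up to a function of the state, then the regularized value is a
negative divergence up to a constant. -/
theorem value_eq_sub_klReg {ρ : S → ℝ} {πref g r π : S → A → ℝ} {β : ℝ} {c : S → ℝ}
    (hπ : IsPolicy π) (hg : ∀ s a, 0 < g s a) (href : ∀ s a, 0 < πref s a)
    (hr : ∀ s, ρ s ≠ 0 → ∀ a, r s a = β * Real.log (g s a / πref s a) + c s) :
    value ρ πref β r π = ∑ s, ρ s * c s - β * klReg ρ g π := by
  simp only [value, expReward, klReg, Finset.mul_sum (a := β), ← Finset.sum_sub_distrib]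
  refine Finset.sum_congr rfl fun s _ => ?_
  by_cases hs : ρ s = 0
  · simp [hs]
  have key : ∀ a, π s a * Real.log (π s a / πref s a)
      = π s a * Real.log (π s a / g s a) + π s a * Real.log (g s a / πref s a) := by
    intro a
    rcases ((hπ s).1 a).eq_or_lt with h0 | h0
    · rw [← h0]; simp
    rw [Real.log_div h0.ne' (href s a).ne', Real.log_div h0.ne' (hg s a).ne',
      Real.log_div (hg s a).ne' (href s a).ne']
    ring
  have h1 : ∑ a, π s a * r s a = β * ∑ a, π s a * Real.log (g s a / πref s a) + c s := by
    rw [Finset.mul_sum]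
    calc ∑ a, π s a * r s a
        = ∑ a, (β * (π s a * Real.log (g s a / πref s a)) + π s a * c s) :=
          Finset.sum_congr rfl fun a _ => by rw [hr s hs a]; ring
      _ = _ := by rw [Finset.sum_add_distrib, ← Finset.sum_mul, (hπ s).2, one_mul]
  rw [h1, Finset.sum_congr rfl fun a _ => key a, Finset.sum_add_distrib]
  ring

/-- The added term `g / π - 1` has mean zero under `π` and makes the integrand nonnegative
pointwise. This allows a termwise comparison with `χ²`, and shows that zero divergence forces
equality on the support of `ρ`. -/
theorem klReg_eq_sum {ρ : S → ℝ} {g π : S → A → ℝ} (hπ : IsPolicy π) (hg : IsPolicy g)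
    (hπ0 : ∀ s a, 0 < π s a) :
    klReg ρ g π
      = ∑ s, ρ s * ∑ a, π s a * (g s a / π s a - 1 - Real.log (g s a / π s a)) := by
  refine Finset.sum_congr rfl fun s _ => ?_
  congr 1
  have : ∀ a, π s a * (g s a / π s a - 1 - Real.log (g s a / π s a))
      = (g s a - π s a) + π s a * Real.log (π s a / g s a) := by
    intro a
    have e : Real.log (π s a / g s a) = -Real.log (g s a / π s a) := by
      rw [← Real.log_inv, inv_div]
    rw [e]
    have := (hπ0 s a).ne'
    field_simp
    ring
  rw [Finset.sum_congr rfl fun a _ => this a, Finset.sum_add_distrib, Finset.sum_sub_distrib,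
    (hπ s).2, (hg s).2]
  ring

/-- The closed form of a full-support optimal policy on the support of `ρ`. -/
theorem IsOptimalPolicy.exists_reward_eq {ρ : S → ℝ} {πref r π : S → A → ℝ} {β : ℝ}
    (hρ : ρ ∈ stdSimplex ℝ S) (href : IsPolicy πref) (hpos : ∀ s a, 0 < πref s a) (hβ : 0 < β)
    (hopt : IsOptimalPolicy ρ πref β r π) (hπ : ∀ s a, 0 < π s a) :
    ∃ c : S → ℝ, ∀ s, ρ s ≠ 0 → ∀ a, r s a = β * Real.log (π s a / πref s a) + c s := by
  set g := gibbs πref r β with hgdef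
  have hg := isPolicy_gibbs href hpos r β
  have hg0 := gibbs_pos href hpos r β
  have hr := fun s (_ : ρ s ≠ 0) a => reward_eq_log_gibbs href hpos r hβ s a
  have hle := hopt.2 g hg
  rw [value_eq_sub_klReg hg hg0 hpos hr, value_eq_sub_klReg hopt.1 hg0 hpos hr,
    klReg_self ρ hg0] at hle
  -- Optimality against the Gibbs policy `g` leaves no divergence; every term then vanishes, and
  -- strictness of `log x < x - 1` gives `π = g` wherever `ρ s ≠ 0`.
  have hkl : klReg ρ g π ≤ 0 := by nlinarith
  rw [klReg_eq_sum hopt.1 hg hπ] at hkl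
  have hterm : ∀ s a, 0 ≤ π s a * (g s a / π s a - 1 - Real.log (g s a / π s a)) := fun s a =>
    mul_nonneg (hπ s a).le (by linarith [Real.log_le_sub_one_of_pos (div_pos (hg0 s a) (hπ s a))])
  have hs0 : ∀ s ∈ Finset.univ, 0 ≤ ρ s *
      ∑ a, π s a * (g s a / π s a - 1 - Real.log (g s a / π s a)) := fun s _ =>
    mul_nonneg (hρ.1 s) (Finset.sum_nonneg fun a _ => hterm s a)
  have hzero := (Finset.sum_eq_zero_iff_of_nonneg hs0).1 (le_antisymm hkl (Finset.sum_nonneg hs0))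
  refine ⟨fun s => β * Real.log (∑ a', πref s a' * Real.exp (r s a' / β)), fun s hs a => ?_⟩
  have h1 := (mul_eq_zero.1 (hzero s (Finset.mem_univ s))).resolve_left hs
  have h2 := (Finset.sum_eq_zero_iff_of_nonneg fun a _ => hterm s a).1 h1 a (Finset.mem_univ a)
  have h3 := (mul_eq_zero.1 h2).resolve_left (hπ s a).ne'
  have h4 : g s a = π s a := by
    by_contra hne
    have := sub_one_sub_log_pos (div_pos (hg0 s a) (hπ s a))
      (fun h => hne ((div_eq_one_iff_eq (hπ s a).ne').1 h))
    linarith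
  rw [← h4]
  exact reward_eq_log_gibbs href hpos r hβ s a

/-- The expectation of `f s a a'` under `s ∼ ρ`, `a ∼ π(·|s)`, `a' ∼ πref(·|s)`. -/
noncomputable def pairMean (ρ : S → ℝ) (πref π : S → A → ℝ) (f : S → A → A → ℝ) : ℝ :=
  ∑ s, ρ s * ∑ a, π s a * ∑ a', πref s a' * f s a a'

theorem pairMean_mono {ρ : S → ℝ} {πref π : S → A → ℝ} (hρ : ∀ s, 0 ≤ ρ s)
    (href : IsPolicy πref) (hπ : IsPolicy π) {f g : S → A → A → ℝ}
    (h : ∀ s a a', f s a a' ≤ g s a a') : pairMean ρ πref π f ≤ pairMean ρ πref π g :=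
  Finset.sum_le_sum fun s _ => mul_le_mul_of_nonneg_left
    (Finset.sum_le_sum fun a _ => mul_le_mul_of_nonneg_left
      (Finset.sum_le_sum fun a' _ => mul_le_mul_of_nonneg_left (h s a a') ((href s).1 a'))
      ((hπ s).1 a)) (hρ s)

theorem pairMean_const {ρ : S → ℝ} {πref π : S → A → ℝ} (hρ : ρ ∈ stdSimplex ℝ S)
    (href : IsPolicy πref) (hπ : IsPolicy π) (c : ℝ) :
    pairMean ρ πref π (fun _ _ _ => c) = c := by
  simp only [pairMean, ← Finset.sum_mul, (href _).2, (hπ _).2, hρ.2, one_mul]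

theorem expReward_sub_expReward {ρ : S → ℝ} {πref π : S → A → ℝ}
    (href : IsPolicy πref) (hπ : IsPolicy π) (r : S → A → ℝ) :
    expReward ρ π r - expReward ρ πref r
      = pairMean ρ πref π (fun s a a' => r s a - r s a') := by
  simp only [expReward, pairMean, ← Finset.sum_sub_distrib]
  refine Finset.sum_congr rfl fun s _ => ?_
  rw [← mul_sub]
  congr 1
  simp only [mul_sub, Finset.sum_sub_distrib, ← Finset.sum_mul, (href s).2, (hπ s).2, one_mul]

/-- The `χ²`-divergence of `π'` from `π`, averaged over the states. -/
noncomputable def chiSq (ρ : S → ℝ) (π π' : S → A → ℝ) : ℝ :=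
  ∑ s, ρ s * ∑ a, π s a * (π' s a / π s a - 1) ^ 2

theorem chiSq_le_kappa_mul_klReg {ρ : S → ℝ} {π π' : S → A → ℝ} {M : ℝ} (hρ : ∀ s, 0 ≤ ρ s)
    (hM : 1 < M) (hπ : IsPolicy π) (hπ' : IsPolicy π') (hπ0 : ∀ s a, 0 < π s a)
    (hπ0' : ∀ s a, 0 < π' s a) (hratio : ∀ s a, π' s a / π s a ≤ M) :
    chiSq ρ π π' ≤ kappa M * klReg ρ π' π := by
  rw [klReg_eq_sum hπ hπ' hπ0, chiSq, Finset.mul_sum]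
  refine Finset.sum_le_sum fun s _ => ?_
  rw [mul_left_comm]
  refine mul_le_mul_of_nonneg_left ?_ (hρ s)
  rw [Finset.mul_sum]
  refine Finset.sum_le_sum fun a _ => ?_
  rw [mul_left_comm]
  exact mul_le_mul_of_nonneg_left
    (sub_one_sq_le_kappa_mul hM (div_pos (hπ0' s a) (hπ0 s a)) (hratio s a)) (hπ0 s a).le

/-- Change of measure from `π'` to `π` at the price of the `χ²`-divergence. -/
theorem pairMean_abs_le {ρ : S → ℝ} {πref π π' : S → A → ℝ} (hρ : ρ ∈ stdSimplex ℝ S)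
    (href : IsPolicy πref) (hπ : IsPolicy π) (hπ' : IsPolicy π') (hπ0 : ∀ s a, 0 < π s a)
    {α : ℝ} (hα : 0 < α) (η : ℝ) (d : S → A → A → ℝ) :
    η * pairMean ρ πref π' (fun s a a' => |d s a a'|)
      ≤ α * pairMean ρ πref π (fun s a a' => d s a a' ^ 2)
        + η ^ 2 / (4 * α) * (1 + chiSq ρ π π') := by
  have hsq : 1 + chiSq ρ π π' = ∑ s, ρ s * ∑ a, π s a * (π' s a / π s a) ^ 2 := by
    rw [chiSq]
    nth_rewrite 1 [← hρ.2]
    rw [← Finset.sum_add_distrib]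
    refine Finset.sum_congr rfl fun s _ => ?_
    have : ∀ a, π s a * (π' s a / π s a) ^ 2
        = π s a * (π' s a / π s a - 1) ^ 2 + 2 * π' s a - π s a := by
      intro a
      have := (hπ0 s a).ne'
      field_simp
      ring
    rw [Finset.sum_congr rfl fun a _ => this a, Finset.sum_sub_distrib, Finset.sum_add_distrib,
      ← Finset.mul_sum, (hπ s).2, (hπ' s).2]
    ring
  rw [hsq]
  simp only [pairMean]
  rw [Finset.mul_sum, Finset.mul_sum, Finset.mul_sum, ← Finset.sum_add_distrib]
  refine Finset.sum_le_sum fun s _ => ?_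
  rw [mul_left_comm η, mul_left_comm α, mul_left_comm (η ^ 2 / (4 * α)), ← mul_add]
  refine mul_le_mul_of_nonneg_left ?_ (hρ.1 s)
  rw [Finset.mul_sum, Finset.mul_sum, Finset.mul_sum, ← Finset.sum_add_distrib]
  refine Finset.sum_le_sum fun a _ => ?_
  have h1 : η ^ 2 / (4 * α) * (π s a * (π' s a / π s a) ^ 2)
      = ∑ a', πref s a' * (η ^ 2 / (4 * α) * (π s a * (π' s a / π s a) ^ 2)) := by
    rw [← Finset.sum_mul, (href s).2, one_mul]
  rw [h1, Finset.mul_sum, Finset.mul_sum, Finset.mul_sum, Finset.mul_sum,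
    ← Finset.sum_add_distrib]
  refine Finset.sum_le_sum fun a' _ => ?_
  have h2 : η * (π' s a * |d s a a'|)
      ≤ α * (π s a * d s a a' ^ 2) + η ^ 2 / (4 * α) * (π s a * (π' s a / π s a) ^ 2) := by
    have hx : π' s a = π s a * (π' s a / π s a) := by
      rw [mul_div_cancel₀ _ (hπ0 s a).ne']
    set x := π' s a / π s a
    -- Young's inequality, with `x` the density of `π'` relative to `π`.
    have h3 : η * x * |d s a a'| ≤ α * d s a a' ^ 2 + η ^ 2 / (4 * α) * x ^ 2 := by
      rw [← sq_abs (d s a a')]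
      have : α * |d s a a'| ^ 2 + η ^ 2 / (4 * α) * x ^ 2 - η * x * |d s a a'|
          = α * (|d s a a'| - η * x / (2 * α)) ^ 2 := by
        field_simp
        ring
      nlinarith [mul_nonneg hα.le (sq_nonneg (|d s a a'| - η * x / (2 * α)))]
    rw [hx]
    nlinarith [mul_le_mul_of_nonneg_left h3 (hπ0 s a).le]
  have := mul_le_mul_of_nonneg_left h2 ((href s).1 a')
  linarith

end RLHF

/-! ### Sequential data and the supermartingale bound -/

namespace RLHF

variable {S A : Type*}

section SequentialData

variable {Ω : Type*} {T : ℕ}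

theorem measurable_history_data (pol : Fin T → Ω → S → A → ℝ)
    (D : Fin T → Ω → S × A × A × Bool) {i j : Fin T} (hij : j < i)
    (z : S × A × A × Bool → ℝ) : Measurable[history pol D i] fun ω => z (D j ω) := by
  have h1 : Measurable[MeasurableSpace.comap (D j) ⊤] fun ω => z (D j ω) :=
    (measurable_from_top : @Measurable _ _ ⊤ _ z).comp (comap_measurable (m := ⊤) (D j))
  exact h1.mono (le_sup_of_le_left (le_iSup
    (fun j : {j : Fin T // j < i} => MeasurableSpace.comap (D j) ⊤) ⟨j, hij⟩)) le_rfl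

theorem measurable_history_pol (pol : Fin T → Ω → S → A → ℝ)
    (D : Fin T → Ω → S × A × A × Bool) {i j : Fin T} (hij : j ≤ i) {w : (S → A → ℝ) → ℝ}
    (hw : Measurable w) : Measurable[history pol D i] fun ω => w (pol j ω) := by
  have h1 : Measurable[MeasurableSpace.comap (pol j) inferInstance] fun ω => w (pol j ω) :=
    hw.comp (comap_measurable (pol j))
  exact h1.mono (le_sup_of_le_right (le_iSup
    (fun j : {j : Fin T // j ≤ i} => MeasurableSpace.comap (pol j) inferInstance) ⟨j, hij⟩)) le_rfl

variable [mΩ : MeasurableSpace Ω] {μ : Measure Ω} {ρ : S → ℝ} {πref r : S → A → ℝ}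
  {pol : Fin T → Ω → S → A → ℝ} {D : Fin T → Ω → S × A × A × Bool}

/-- Preferences depend only on reward gaps, and only states in the support of `ρ` are sampled. Hence
the true reward may be replaced by the one converted from `π*`. -/
theorem IsSequentialData.congr_reward (h : IsSequentialData μ ρ πref r pol D) {r' : S → A → ℝ}
    (hr : ∀ s, ρ s ≠ 0 → ∀ a a', r s a - r s a' = r' s a - r' s a') :
    IsSequentialData μ ρ πref r' pol D where
  measurable_pol := h.measurable_pol
  measurable_data := h.measurable_data
  cond_law i x := by
    refine (h.cond_law i x).trans (ae_of_all _ fun ω => ?_)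
    dsimp only [sampleProb, prefProb]
    by_cases hs : ρ x.1 = 0
    · simp [hs]
    · rw [hr _ hs, hr _ hs]

variable [Fintype S] [Fintype A]

theorem IsSequentialData.comap_data_le (h : IsSequentialData μ ρ πref r pol D) (i : Fin T) :
    MeasurableSpace.comap (D i) ⊤ ≤ mΩ := by
  rintro _ ⟨s, -, rfl⟩
  have : D i ⁻¹' s = ⋃ x ∈ s, {ω | D i ω = x} := by ext; simp
  rw [this]
  exact MeasurableSet.biUnion s.toFinite.countable fun x _ => h.measurable_data i x

theorem IsSequentialData.history_le (h : IsSequentialData μ ρ πref r pol D) (i : Fin T) :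
    history pol D i ≤ mΩ :=
  sup_le (iSup_le fun j => h.comap_data_le j) (iSup_le fun j => (h.measurable_pol j).comap_le)

/-- Integrating out the sample of a round given the history. -/
theorem IsSequentialData.integral_mul [IsProbabilityMeasure μ]
    (h : IsSequentialData μ ρ πref r pol D) (i : Fin T) {G : Ω → ℝ}
    (hG : Measurable[history pol D i] G) {c : ℝ} (hc : ∀ᵐ ω ∂μ, ‖G ω‖ ≤ c)
    (z : S × A × A × Bool → ℝ) :
    ∫ ω, G ω * z (D i ω) ∂μ
      = ∫ ω, G ω * ∑ x, sampleProb ρ πref r (pol i ω) x * z x ∂μ := by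
  classical
  have hm := h.history_le i
  have hGm : AEStronglyMeasurable G μ := (hG.mono hm le_rfl).aestronglyMeasurable
  set I : S × A × A × Bool → Ω → ℝ := fun x => Set.indicator {ω | D i ω = x} fun _ => (1 : ℝ)
  have hI : ∀ x, Integrable (I x) μ := fun x =>
    (integrable_const 1).indicator (h.measurable_data i x)
  have hGI : ∀ x, Integrable (fun ω => G ω * I x ω) μ := fun x => (hI x).bdd_mul hGm hc
  have hpull : ∀ x, μ[fun ω => G ω * I x ω | history pol D i]
      =ᵐ[μ] fun ω => G ω * sampleProb ρ πref r (pol i ω) x := fun x =>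
    (condExp_stronglyMeasurable_mul_of_bound hm hG.stronglyMeasurable (hI x) c hc).trans
      ((h.cond_law i x).mono fun ω hω => by rw [Pi.mul_apply, hω])
  have hint : ∀ x, Integrable (fun ω => G ω * sampleProb ρ πref r (pol i ω) x) μ := fun x =>
    integrable_condExp.congr (hpull x)
  have heq : ∀ x, ∫ ω, G ω * I x ω ∂μ = ∫ ω, G ω * sampleProb ρ πref r (pol i ω) x ∂μ :=
    fun x => by rw [← integral_condExp hm, integral_congr_ae (hpull x)]
  calc ∫ ω, G ω * z (D i ω) ∂μ = ∫ ω, ∑ x, G ω * I x ω * z x ∂μ := by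
        refine integral_congr_ae (ae_of_all _ fun ω => ?_)
        dsimp only
        rw [Finset.sum_eq_single (D i ω)]
        · simp [I]
        · intro x _ hx
          simp [I, hx.symm]
        · simp
    _ = ∑ x, (∫ ω, G ω * I x ω ∂μ) * z x := by
        rw [integral_finsetSum _ fun x _ => (hGI x).mul_const _]
        simp_rw [integral_mul_const]
    _ = ∫ ω, ∑ x, G ω * sampleProb ρ πref r (pol i ω) x * z x ∂μ := by
        rw [integral_finsetSum _ fun x _ => (hint x).mul_const _]
        simp_rw [integral_mul_const, heq]
    _ = _ := by simp_rw [Finset.mul_sum, mul_assoc]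

/-- The product of weights with conditional mean at most one is a supermartingale. -/
theorem IsSequentialData.integral_prod_le_one [IsProbabilityMeasure μ]
    (h : IsSequentialData μ ρ πref r pol D) (hpol : ∀ᵐ ω ∂μ, ∀ i, IsPolicy (pol i ω))
    {z : S × A × A × Bool → ℝ} (hz : ∀ x, 0 ≤ z x) {w : (S → A → ℝ) → ℝ} (hw : Measurable w)
    (hw0 : ∀ π, 0 ≤ w π) {W : ℝ} (hW : ∀ π, IsPolicy π → w π ≤ W)
    (hmean : ∀ π, IsPolicy π → w π * ∑ x, sampleProb ρ πref r π x * z x ≤ 1) :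
    Integrable (fun ω => ∏ i, z (D i ω) * w (pol i ω)) μ ∧
      ∫ ω, ∏ i, z (D i ω) * w (pol i ω) ∂μ ≤ 1 := by
  set s : ℕ → Finset (Fin T) := fun k => Finset.univ.filter fun i => i.val < k
  set M : ℕ → Ω → ℝ := fun k ω => ∏ i ∈ s k, z (D i ω) * w (pol i ω) with hM
  have hM0 : ∀ k ω, 0 ≤ M k ω := fun k ω =>
    Finset.prod_nonneg fun i _ => mul_nonneg (hz _) (hw0 _)
  have hbound : ∀ k, ∃ B, ∀ᵐ ω ∂μ, M k ω ≤ B := by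
    intro k
    -- A crude bound, needed only for integrability.
    refine ⟨∏ i ∈ s k, ((∑ x, z x) * W), ?_⟩
    filter_upwards [hpol] with ω hω
    refine Finset.prod_le_prod (fun i _ => mul_nonneg (hz _) (hw0 _)) fun i _ => ?_
    exact mul_le_mul (Finset.single_le_sum (fun x _ => hz x) (Finset.mem_univ (D i ω)))
      (hW _ (hω i)) (hw0 _) (Finset.sum_nonneg fun x _ => hz x)
  have hzm : ∀ i, Measurable fun ω => z (D i ω) := fun i =>
    ((measurable_from_top : @Measurable _ _ ⊤ _ z).comp
      (comap_measurable (m := ⊤) (D i))).mono (h.comap_data_le i) le_rfl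
  have hint : ∀ k, Integrable (M k) μ := by
    intro k
    obtain ⟨B, hB⟩ := hbound k
    refine Integrable.of_bound (Measurable.aestronglyMeasurable ?_) B
      (hB.mono fun ω hω => by rwa [Real.norm_of_nonneg (hM0 k ω)])
    exact Finset.measurable_prod _ fun i _ => (hzm i).mul (hw.comp (h.measurable_pol i))
  have hstep : ∀ k, k ≤ T → ∫ ω, M k ω ∂μ ≤ 1 := by
    intro k
    induction k with
    | zero => intro _; simp [hM, s]
    | succ k ih =>
      intro hk
      refine le_trans ?_ (ih (by omega))
      set i : Fin T := ⟨k, hk⟩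
      have hs : s (k + 1) = insert i (s k) := by
        ext j
        simp only [s, Finset.mem_filter, Finset.mem_univ, true_and, Finset.mem_insert, Fin.ext_iff,
          i]
        omega
      have hi : i ∉ s k := by simp [s, i]
      have hMk : ∀ ω, M (k + 1) ω = M k ω * w (pol i ω) * z (D i ω) := by
        intro ω
        simp only [hM]
        rw [hs, Finset.prod_insert hi]
        ring
      -- The history of round `i` contains the policy of that round, so the compensator `w (pol i)`
      -- is known before the sample is drawn.
      have hGm : Measurable[history pol D i] fun ω => M k ω * w (pol i ω) := by
        refine Measurable.mul ?_ (measurable_history_pol pol D le_rfl hw)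
        refine Finset.measurable_prod _ fun j hj => ?_
        have hj' : j < i := (Finset.mem_filter.1 hj).2
        exact (measurable_history_data pol D hj' z).mul
          (measurable_history_pol pol D hj'.le hw)
      obtain ⟨B, hB⟩ := hbound k
      have hGb : ∀ᵐ ω ∂μ, ‖M k ω * w (pol i ω)‖ ≤ B * W := by
        filter_upwards [hB, hpol] with ω h1 h2
        rw [Real.norm_of_nonneg (mul_nonneg (hM0 k ω) (hw0 _))]
        exact mul_le_mul h1 (hW _ (h2 i)) (hw0 _) ((hM0 k ω).trans h1)
      simp_rw [hMk]
      rw [h.integral_mul i hGm hGb z]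
      -- If the integrand is not integrable, its integral is `0` by convention, which is below the
      -- integral of `M k ≥ 0`.
      by_cases hf : Integrable
          (fun ω => M k ω * w (pol i ω) * ∑ x, sampleProb ρ πref r (pol i ω) x * z x) μ
      · refine integral_mono_ae hf (hint k) ?_
        filter_upwards [hpol] with ω hω
        have := mul_le_mul_of_nonneg_left (hmean _ (hω i)) (hM0 k ω)
        rwa [mul_one, ← mul_assoc] at this
      · rw [integral_undef hf]
        exact integral_nonneg (hM0 k)
  have huniv : s T = Finset.univ := by ext j; simp [s]
  have h1 := hint T
  have h2 := hstep T le_rfl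
  simp only [hM, huniv] at h1 h2
  exact ⟨h1, h2⟩

end SequentialData

end RLHF

/-! ### Concentration of the log-likelihood -/

namespace RLHF

theorem prefProb_pos {S A : Type*} (r : S → A → ℝ) (s : S) (a a' : A) (y : Bool) :
    0 < prefProb r s a a' y := by
  unfold prefProb
  split_ifs <;> exact Real.sigmoid_pos _

/-- The curvature constant `(e^R / (1 + e^R)²)²` of the preference model on `[-R, R]`. -/
noncomputable def curvature (R : ℝ) : ℝ := (Real.exp R / (1 + Real.exp R) ^ 2) ^ 2

theorem curvature_pos (R : ℝ) : 0 < curvature R := by unfold curvature; positivity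

/-- The squared difference of the reward gaps of two rewards on a pair of actions. -/
noncomputable def gapSq {S A : Type*} (r r' : S → A → ℝ) (s : S) (a a' : A) : ℝ :=
  ((r s a - r s a') - (r' s a - r' s a')) ^ 2

/-- The left side is the Bhattacharyya coefficient of two Bernoulli laws. Its loss is quadratic in
the difference of the probabilities, hence in that of the reward gaps, since the sigmoid has slope
bounded below on `[-R, R]`. -/
theorem sum_prefProb_mul_sqrt_le {S A : Type*} {r r₀ : S → A → ℝ} {R : ℝ}
    (hr : ∀ s a, r s a ∈ Set.Icc 0 R) (hr₀ : ∀ s a, r₀ s a ∈ Set.Icc 0 R) (s : S) (a a' : A) :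
    ∑ y, prefProb r₀ s a a' y * √(prefProb r s a a' y / prefProb r₀ s a a' y)
      ≤ 1 - curvature R / 2 * gapSq r r₀ s a a' := by
  have hΔ : ∀ r : S → A → ℝ, (∀ s a, r s a ∈ Set.Icc 0 R) → |r s a - r s a'| ≤ R := fun r h =>
    abs_sub_le_iff.2 ⟨by linarith [(h s a).2, (h s a').1], by linarith [(h s a').2, (h s a).1]⟩
  have hsqrt : ∀ y, prefProb r₀ s a a' y * √(prefProb r s a a' y / prefProb r₀ s a a' y)
      = √(prefProb r s a a' y * prefProb r₀ s a a' y) := by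
    intro y
    have h0 := prefProb_pos r₀ s a a' y
    rw [show prefProb r s a a' y * prefProb r₀ s a a' y
        = prefProb r₀ s a a' y ^ 2 * (prefProb r s a a' y / prefProb r₀ s a a' y) by field_simp,
      Real.sqrt_mul (sq_nonneg _), Real.sqrt_sq h0.le]
  simp_rw [hsqrt]
  have hneg : ∀ r : S → A → ℝ, Real.sigmoid (r s a' - r s a)
      = 1 - Real.sigmoid (r s a - r s a') := fun r => by rw [← Real.sigmoid_neg, neg_sub]
  rw [Fintype.sum_bool]
  simp only [prefProb, if_true, Bool.false_eq_true, if_false, hneg]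
  refine (sqrt_mul_add_sqrt_mul_le (Real.sigmoid_nonneg _) (Real.sigmoid_le_one _)
    (Real.sigmoid_nonneg _) (Real.sigmoid_le_one _)).trans ?_
  have := mul_sub_sq_le_sigmoid_sub_sq (hΔ r hr) (hΔ r₀ hr₀)
  unfold curvature gapSq
  linarith

variable {S A : Type*} [Fintype S] [Fintype A]

theorem sum_sampleProb_mul (ρ : S → ℝ) (πref r π : S → A → ℝ) (z : S × A × A × Bool → ℝ) :
    ∑ x, sampleProb ρ πref r π x * z x
      = pairMean ρ πref π fun s a a' => ∑ y, prefProb r s a a' y * z (s, a, a', y) := by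
  simp only [Fintype.sum_prod_type, pairMean, Finset.mul_sum, sampleProb]
  refine Finset.sum_congr rfl fun s _ => Finset.sum_congr rfl fun a _ =>
    Finset.sum_congr rfl fun a' _ => Finset.sum_congr rfl fun y _ => ?_
  ring

theorem pairMean_one_sub_mul {ρ : S → ℝ} {πref π : S → A → ℝ} (hρ : ρ ∈ stdSimplex ℝ S)
    (href : IsPolicy πref) (hπ : IsPolicy π) (c : ℝ) (f : S → A → A → ℝ) :
    pairMean ρ πref π (fun s a a' => 1 - c * f s a a') = 1 - c * pairMean ρ πref π f := by
  have h := pairMean_const hρ href hπ 1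
  simp only [pairMean, mul_one] at h
  simp only [pairMean, mul_sub, Finset.sum_sub_distrib, mul_one, h, mul_left_comm _ c,
    ← Finset.mul_sum]

theorem continuous_pairMean (ρ : S → ℝ) (πref : S → A → ℝ) (f : S → A → A → ℝ) :
    Continuous fun π => pairMean ρ πref π f := by
  unfold pairMean
  fun_prop

/-- Concentration of the log-likelihood ratio of two rewards, `r₀` being the true one. -/
theorem IsSequentialData.measure_nll_sub_le {Ω : Type*} [MeasurableSpace Ω] {μ : Measure Ω}
    [IsProbabilityMeasure μ] {ρ : S → ℝ} {πref r₀ r : S → A → ℝ} {T : ℕ}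
    {pol : Fin T → Ω → S → A → ℝ} {D : Fin T → Ω → S × A × A × Bool} {R : ℝ}
    (h : IsSequentialData μ ρ πref r₀ pol D) (hρ : ρ ∈ stdSimplex ℝ S) (href : IsPolicy πref)
    (hpol : ∀ᵐ ω ∂μ, ∀ i, IsPolicy (pol i ω)) (hr : ∀ s a, r s a ∈ Set.Icc 0 R)
    (hr₀ : ∀ s a, r₀ s a ∈ Set.Icc 0 R) (hT : 0 < T) {K : ℝ} (hK : 0 < K) :
    μ {ω | ¬ (nll (fun i => D i ω) r₀ - nll (fun i => D i ω) r
        ≤ 2 / T * Real.log K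
          - curvature R / T * ∑ i, pairMean ρ πref (pol i ω) (gapSq r r₀))}
      ≤ ENNReal.ofReal (1 / K) := by
  set α := curvature R
  have hα : 0 < α := curvature_pos R
  -- The likelihood ratio itself has conditional mean one; its square root has mean at most `exp
  -- (-(α / 2) g)`. Compensating by `exp (α / 2 * g)` produces the negative quadratic term.
  set z : S × A × A × Bool → ℝ := fun x =>
    √(prefProb r x.1 x.2.1 x.2.2.1 x.2.2.2 / prefProb r₀ x.1 x.2.1 x.2.2.1 x.2.2.2) with hz
  have hzpos : ∀ x, 0 < z x := fun x =>
    Real.sqrt_pos.2 (div_pos (prefProb_pos _ _ _ _ _) (prefProb_pos _ _ _ _ _))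
  set g : (S → A → ℝ) → ℝ := fun π => pairMean ρ πref π (gapSq r r₀) with hg
  have hg1 : ∀ π, IsPolicy π → g π ≤ (2 * R) ^ 2 := by
    intro π hπ
    refine (pairMean_mono hρ.1 href hπ fun s a a' => ?_).trans_eq (pairMean_const hρ href hπ _)
    have := hr s a
    have := hr s a'
    have := hr₀ s a
    have := hr₀ s a'
    simp only [Set.mem_Icc] at *
    refine sq_le_sq' ?_ ?_ <;> linarith
  have hmean : ∀ π, IsPolicy π →
      Real.exp (α / 2 * g π) * ∑ x, sampleProb ρ πref r₀ π x * z x ≤ 1 := by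
    intro π hπ
    have h1 : ∑ x, sampleProb ρ πref r₀ π x * z x ≤ Real.exp (-(α / 2 * g π)) := by
      rw [sum_sampleProb_mul]
      refine (pairMean_mono hρ.1 href hπ fun s a a' =>
        sum_prefProb_mul_sqrt_le hr hr₀ s a a').trans ?_
      rw [pairMean_one_sub_mul hρ href hπ]
      exact Real.one_sub_le_exp_neg _
    refine (mul_le_mul_of_nonneg_left h1 (Real.exp_pos _).le).trans_eq ?_
    rw [← Real.exp_add, add_neg_cancel, Real.exp_zero]
  have hwm : Measurable fun π : S → A → ℝ => Real.exp (α / 2 * g π) :=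
    (Real.continuous_exp.comp ((continuous_pairMean ρ πref _).const_mul _)).measurable
  obtain ⟨hint, hle⟩ := h.integral_prod_le_one hpol (z := z) (fun x => Real.sqrt_nonneg _) hwm
    (fun π => (Real.exp_pos _).le) (W := Real.exp (α / 2 * (2 * R) ^ 2))
    (fun π hπ => Real.exp_le_exp.2 (mul_le_mul_of_nonneg_left (hg1 π hπ) (by positivity))) hmean
  set F : Ω → ℝ := fun ω => ∏ i, z (D i ω) * Real.exp (α / 2 * g (pol i ω)) with hF
  have hF0 : ∀ ω, 0 < F ω := fun ω =>
    Finset.prod_pos fun i _ => mul_pos (hzpos _) (Real.exp_pos _)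
  have hmarkov := mul_meas_ge_le_integral_of_nonneg (ae_of_all μ fun ω => (hF0 ω).le) hint K
  have hT' : (0 : ℝ) < T := Nat.cast_pos.2 hT
  have hlog : ∀ ω, Real.log (F ω) = T / 2 * (nll (fun i => D i ω) r₀ - nll (fun i => D i ω) r)
      + α / 2 * ∑ i, g (pol i ω) := by
    intro ω
    rw [hF, Real.log_prod fun i _ => (mul_pos (hzpos _) (Real.exp_pos _)).ne']
    have : ∀ i, Real.log (z (D i ω) * Real.exp (α / 2 * g (pol i ω)))
        = (-Real.log (prefProb r₀ (D i ω).1 (D i ω).2.1 (D i ω).2.2.1 (D i ω).2.2.2)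
          - -Real.log (prefProb r (D i ω).1 (D i ω).2.1 (D i ω).2.2.1 (D i ω).2.2.2)) / 2
          + α / 2 * g (pol i ω) := by
      intro i
      rw [Real.log_mul (hzpos _).ne' (Real.exp_pos _).ne', Real.log_exp, hz,
        Real.log_sqrt (div_pos (prefProb_pos _ _ _ _ _) (prefProb_pos _ _ _ _ _)).le,
        Real.log_div (prefProb_pos _ _ _ _ _).ne' (prefProb_pos _ _ _ _ _).ne']
      ring
    simp_rw [this]
    rw [Finset.sum_add_distrib, ← Finset.sum_div, Finset.sum_sub_distrib, ← Finset.mul_sum]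
    unfold nll
    field_simp
  have hsub : {ω | ¬ (nll (fun i => D i ω) r₀ - nll (fun i => D i ω) r
      ≤ 2 / T * Real.log K - α / T * ∑ i, g (pol i ω))} ⊆ {ω | K ≤ F ω} := by
    intro ω hω
    simp only [Set.mem_ofPred_eq, not_le] at hω ⊢
    have h1 : Real.log K < Real.log (F ω) := by
      rw [hlog]
      have := mul_lt_mul_of_pos_left hω (half_pos hT')
      have e : (T : ℝ) / 2 * (2 / T * Real.log K - α / T * ∑ i, g (pol i ω))
          = Real.log K - α / 2 * ∑ i, g (pol i ω) := by
        field_simp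
      linarith
    exact ((Real.log_lt_log_iff hK (hF0 ω)).1 h1).le
  refine (measure_mono hsub).trans ?_
  rw [← ofReal_measureReal]
  refine ENNReal.ofReal_le_ofReal ?_
  rw [le_div_iff₀ hK]
  linarith

end RLHF

/-! ### RPO: existence of solutions and the max-min argument -/

namespace RLHF

variable {S A : Type*} [Fintype S] [Fintype A]

/-- Continuity of `x log x` at `0` covers policies without full support. -/
theorem continuous_klReg (ρ : S → ℝ) {πref : S → A → ℝ} (hpos : ∀ s a, 0 < πref s a) :
    Continuous fun π => klReg ρ πref π := by
  have h : ∀ π : S → A → ℝ, klReg ρ πref π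
      = ∑ s, ρ s * ∑ a, (π s a * Real.log (π s a) - π s a * Real.log (πref s a)) := by
    intro π
    refine Finset.sum_congr rfl fun s _ => ?_
    congr 1
    refine Finset.sum_congr rfl fun a _ => ?_
    rcases eq_or_ne (π s a) 0 with h0 | h0
    · simp [h0]
    · rw [Real.log_div h0 (hpos s a).ne', mul_sub]
  simp_rw [h]
  have hlog : ∀ s a, Continuous fun π : S → A → ℝ => π s a * Real.log (π s a) := fun s a =>
    Real.continuous_mul_log.comp (by fun_prop : Continuous fun π : S → A → ℝ => π s a)
  fun_prop

theorem continuous_rpoObjective (ρ : S → ℝ) {πref : S → A → ℝ} (hpos : ∀ s a, 0 < πref s a)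
    (β η : ℝ) {T : ℕ} (D : Fin T → S × A × A × Bool) (r : S → A → ℝ) :
    Continuous fun π => rpoObjective ρ πref β η D π r := by
  have := continuous_klReg ρ hpos
  unfold rpoObjective expReward
  fun_prop

theorem exists_isRPOSolution (ρ : S → ℝ) {πref : S → A → ℝ} (hpos : ∀ s a, 0 < πref s a)
    (β η : ℝ) {Q : Set (S → A → ℝ)} (hQ : IsCompact Q) (hQ0 : Q.Nonempty)
    {𝓡 : Set (S → A → ℝ)} (h𝓡 : 𝓡.Finite) (h𝓡0 : 𝓡.Nonempty) {T : ℕ}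
    (D : Fin T → S × A × A × Bool) : ∃ π, IsRPOSolution ρ πref β η Q 𝓡 D π := by
  lift 𝓡 to Finset (S → A → ℝ) using h𝓡
  have hne : 𝓡.Nonempty := Finset.coe_nonempty.1 h𝓡0
  have heq : (fun π => sInf (rpoObjective ρ πref β η D π '' (𝓡 : Set (S → A → ℝ))))
      = fun π => 𝓡.inf' hne fun r => rpoObjective ρ πref β η D π r :=
    funext fun π => (Finset.inf'_eq_csInf_image 𝓡 hne _).symm
  have hcont : Continuous
      fun π => sInf (rpoObjective ρ πref β η D π '' (𝓡 : Set (S → A → ℝ))) := by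
    rw [heq]
    exact Continuous.finset_inf'_apply hne fun r _ => continuous_rpoObjective ρ hpos β η D r
  obtain ⟨π, hπ, hmax⟩ := hQ.exists_isMaxOn hQ0 hcont.continuousOn
  exact ⟨π, hπ, fun π' hπ' => hmax hπ'⟩

/-- Here `r` is the minimizer against the comparator, while `r₀` bounds the minimum at the output
from above; no minimax theorem is needed. -/
theorem IsRPOSolution.exists_objective_le {ρ : S → ℝ} {πref : S → A → ℝ} {β η : ℝ}
    {Q 𝓡 : Set (S → A → ℝ)} (h𝓡 : 𝓡.Finite) {T : ℕ} {D : Fin T → S × A × A × Bool}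
    {π π' r₀ : S → A → ℝ} (h : IsRPOSolution ρ πref β η Q 𝓡 D π) (hπ' : π' ∈ Q) (hr₀ : r₀ ∈ 𝓡) :
    ∃ r ∈ 𝓡, rpoObjective ρ πref β η D π' r ≤ rpoObjective ρ πref β η D π r₀ := by
  obtain ⟨r, hr, hrmin⟩ := (Set.Nonempty.image (rpoObjective ρ πref β η D π')
    ⟨r₀, hr₀⟩).csInf_mem (h𝓡.image _)
  refine ⟨r, hr, ?_⟩
  rw [hrmin]
  exact (h.2 π' hπ').trans (csInf_le (h𝓡.image _).bddBelow (Set.mem_image_of_mem _ hr₀))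

/-- The value gap of the RPO output on the event that the log-likelihood concentrates, when the
data-collecting policies are close to the comparator. -/
theorem IsRPOSolution.value_sub_le {ρ : S → ℝ} {πref πstar πhat r₀ : S → A → ℝ} {β η α L : ℝ}
    {Q 𝓡 : Set (S → A → ℝ)} {T : ℕ} {D : Fin T → S × A × A × Bool} {pol : Fin T → S → A → ℝ}
    (hsol : IsRPOSolution ρ πref β η Q 𝓡 D πhat) (h𝓡 : 𝓡.Finite) (hρ : ρ ∈ stdSimplex ℝ S)
    (href : IsPolicy πref) (hQ : ∀ π ∈ Q, IsPolicy π) (hstar : πstar ∈ Q) (hr₀ : r₀ ∈ 𝓡)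
    (hT : 0 < T) (hη : 0 < η) (hα : 0 < α) (hpol : ∀ i, IsPolicy (pol i))
    (hpol0 : ∀ i s a, 0 < pol i s a) (hχ : ∑ i, chiSq ρ (pol i) πstar ≤ T)
    (hnll : ∀ r ∈ 𝓡, nll D r₀ - nll D r
      ≤ 2 / T * L - α / T * ∑ i, pairMean ρ πref (pol i) (gapSq r r₀)) :
    value ρ πref β r₀ πstar - value ρ πref β r₀ πhat ≤ η / (2 * α) + 2 * L / (T * η) := by
  have hT' : (0 : ℝ) < T := Nat.cast_pos.2 hT
  obtain ⟨r, hr, hle⟩ := hsol.exists_objective_le h𝓡 hstar hr₀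
  have hπs := hQ _ hstar
  set m := pairMean ρ πref πstar fun s a a' => |(r s a - r s a') - (r₀ s a - r₀ s a')| with hm
  have hdiff : (expReward ρ πstar r₀ - expReward ρ πref r₀)
      - (expReward ρ πstar r - expReward ρ πref r) ≤ m := by
    rw [expReward_sub_expReward href hπs, expReward_sub_expReward href hπs]
    have : pairMean ρ πref πstar (fun s a a' => r₀ s a - r₀ s a')
        ≤ pairMean ρ πref πstar (fun s a a' => r s a - r s a') + m := by
      have e : pairMean ρ πref πstar (fun s a a' => r s a - r s a') + m
          = pairMean ρ πref πstar fun s a a' =>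
            (r s a - r s a') + |(r s a - r s a') - (r₀ s a - r₀ s a')| := by
        simp only [hm, pairMean, mul_add, Finset.sum_add_distrib]
      rw [e]
      exact pairMean_mono hρ.1 href hπs fun s a a' => by
        linarith [neg_abs_le ((r s a - r s a') - (r₀ s a - r₀ s a'))]
    linarith
  have hsum : T * (η * m) ≤ α * ∑ i, pairMean ρ πref (pol i) (gapSq r r₀)
      + η ^ 2 / (4 * α) * (T + ∑ i, chiSq ρ (pol i) πstar) := by
    have h1 := Finset.sum_le_sum fun i (_ : i ∈ Finset.univ) =>
      pairMean_abs_le hρ href (hpol i) hπs (hpol0 i) hα η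
        fun s a a' => (r s a - r s a') - (r₀ s a - r₀ s a')
    rw [Finset.sum_const, Finset.card_univ, Fintype.card_fin, nsmul_eq_mul,
      Finset.sum_add_distrib, ← Finset.mul_sum, ← Finset.mul_sum, Finset.sum_add_distrib,
      Finset.sum_const, Finset.card_univ, Fintype.card_fin, nsmul_eq_mul, mul_one] at h1
    exact h1
  have hnll' := hnll r hr
  set G := ∑ i, pairMean ρ πref (pol i) (gapSq r r₀)
  have h2 : η * m ≤ α / T * G + η ^ 2 / (2 * α) := by
    -- By `hχ` the second moment `1 + χ²` of the density is at most `2` on average over the rounds.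
    have h3 : η ^ 2 / (4 * α) * (T + ∑ i, chiSq ρ (pol i) πstar) ≤ η ^ 2 / (4 * α) * (T + T) := by
      gcongr
    have h4 : T * (η * m) ≤ T * (α / T * G + η ^ 2 / (2 * α)) := by
      refine (hsum.trans (add_le_add_right h3 _)).trans_eq ?_
      field_simp
      ring
    exact le_of_mul_le_mul_left h4 hT'
  have h5 : η * (value ρ πref β r₀ πstar - value ρ πref β r₀ πhat)
      ≤ η * (η / (2 * α) + 2 * L / (T * η)) := by
    have e : η * (η / (2 * α) + 2 * L / (T * η)) = 2 / T * L + η ^ 2 / (2 * α) := by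
      field_simp
      ring
    rw [e]
    unfold rpoObjective at hle
    unfold value
    -- The term `α / T * G` of `h2` cancels against the negative term of `hnll'`.
    nlinarith [mul_le_mul_of_nonneg_left hdiff hη.le]
  exact le_of_mul_le_mul_left h5 hη

theorem rpoWeight_pos {R δ : ℝ} {N T : ℕ} (hL : 0 < Real.log (N / δ)) (hT : 0 < T) :
    0 < rpoWeight R δ N T := by
  have : (0 : ℝ) < T := Nat.cast_pos.2 hT
  unfold rpoWeight
  positivity

/-- Since `1 + e^R ≤ 2 e^R`, the first term is at most a constant times `√(L / T)` and only the
second carries `e^{2R}`. The crude constants are `10` and `2`. -/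
theorem rpoWeight_bound {R δ : ℝ} {N T : ℕ} (hR : 0 ≤ R) (hL : 0 < Real.log (N / δ))
    (hT : 0 < T) :
    rpoWeight R δ N T / (2 * curvature R)
        + 2 * Real.log (N / δ) / (T * rpoWeight R δ N T)
      ≤ 12 * Real.exp (2 * R) * √(Real.log (N / δ) / T) := by
  have hT' : (0 : ℝ) < T := Nat.cast_pos.2 hT
  have hE : 1 ≤ Real.exp R := Real.one_le_exp hR
  have hE2 : Real.exp (2 * R) = Real.exp R ^ 2 := by rw [← Real.exp_nat_mul]; norm_num
  rw [rpoWeight, curvature, hE2]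
  set E := Real.exp R
  set L := Real.log (N / δ)
  have hq : 0 < √(L / T) := Real.sqrt_pos.2 (by positivity)
  have hL' : L = √(L / T) ^ 2 * T := by rw [Real.sq_sqrt (by positivity)]; field_simp
  have hs : √(24 / T * L) = √24 * √(L / T) := by
    rw [← Real.sqrt_mul (by norm_num)]; congr 1; ring
  rw [hs]
  set q := √(L / T)
  have h24 : 4 ≤ √24 := Real.le_sqrt_of_sq_le (by norm_num)
  have h24' : √24 ≤ 5 := Real.sqrt_le_iff.2 (by norm_num)
  have e1 : ((1 + E) ^ 2)⁻¹ * (√24 * q) / (2 * (E / (1 + E) ^ 2) ^ 2)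
      = √24 * q * ((1 + E) ^ 2 / (2 * E ^ 2)) := by
    field_simp
  have e2 : 2 * L / (T * (((1 + E) ^ 2)⁻¹ * (√24 * q))) = q * (1 + E) ^ 2 * (2 / √24) := by
    rw [hL']
    field_simp
  rw [e1, e2]
  have hE4 : (1 + E) ^ 2 ≤ 4 * E ^ 2 := by nlinarith
  have h1 : (1 + E) ^ 2 / (2 * E ^ 2) ≤ 2 * E ^ 2 := by
    rw [div_le_iff₀ (by positivity)]
    nlinarith [one_le_pow₀ hE (n := 2)]
  have h2 : 2 / √24 ≤ 1 / 2 := by rw [div_le_iff₀ (by positivity)]; linarith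
  calc √24 * q * ((1 + E) ^ 2 / (2 * E ^ 2)) + q * (1 + E) ^ 2 * (2 / √24)
      ≤ 5 * q * (2 * E ^ 2) + q * (4 * E ^ 2) * (1 / 2) := by gcongr
    _ = 12 * E ^ 2 * q := by ring

end RLHF

/-! ### Coverage of `π*` by the policy class, and the gap after the burn-in -/

namespace RLHF

section PolicyClass

variable {S A : Type*} [Fintype A] {πref πstar : S → A → ℝ} {β R : ℝ} {P : Finset (S → A → ℝ)}

theorem PolicyClassAssumption.mem_Icc (h : PolicyClassAssumption πref β R πstar P)
    (hpos : ∀ s a, 0 < πref s a) {π : S → A → ℝ} (hπ : π ∈ P) (s : S) (a : A) :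
    π s a ∈ Set.Icc (πref s a * Real.exp (-(R / β))) (πref s a * Real.exp (R / β)) := by
  have h1 := abs_le.1 (h.bounded_ratio π hπ s a)
  have h2 : π s a = πref s a * Real.exp (Real.log (π s a / πref s a)) := by
    rw [Real.exp_log (div_pos (h.pos π hπ s a) (hpos s a)), mul_div_cancel₀ _ (hpos s a).ne']
  rw [h2]
  exact ⟨mul_le_mul_of_nonneg_left (Real.exp_le_exp.2 h1.1) (hpos s a).le,
    mul_le_mul_of_nonneg_left (Real.exp_le_exp.2 h1.2) (hpos s a).le⟩

theorem PolicyClassAssumption.isPolicy_of_mem_convexHull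
    (h : PolicyClassAssumption πref β R πstar P) {π : S → A → ℝ}
    (hπ : π ∈ convexHull ℝ (P : Set (S → A → ℝ))) : IsPolicy π :=
  IsPolicy.convexHull (fun π hπ => h.isPolicy π hπ) hπ

/-- Only the lower end of the band is needed on the hull: in the ratio `π*/π` the numerator belongs
to the class itself. -/
theorem PolicyClassAssumption.le_of_mem_convexHull (h : PolicyClassAssumption πref β R πstar P)
    (hpos : ∀ s a, 0 < πref s a) {π : S → A → ℝ}
    (hπ : π ∈ convexHull ℝ (P : Set (S → A → ℝ))) (s : S) (a : A) :
    πref s a * Real.exp (-(R / β)) ≤ π s a :=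
  RLHF.le_of_mem_convexHull (f := fun s a => πref s a * Real.exp (-(R / β)))
    (fun _ hπ s a => (h.mem_Icc hpos hπ s a).1) hπ s a

theorem PolicyClassAssumption.pos_of_mem_convexHull (h : PolicyClassAssumption πref β R πstar P)
    (hpos : ∀ s a, 0 < πref s a) {π : S → A → ℝ}
    (hπ : π ∈ convexHull ℝ (P : Set (S → A → ℝ))) (s : S) (a : A) : 0 < π s a :=
  lt_of_lt_of_le (mul_pos (hpos s a) (Real.exp_pos _)) (h.le_of_mem_convexHull hpos hπ s a)

variable [Fintype S]

/-- The optimal policy is covered by every policy whose regret is small. -/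
theorem PolicyClassAssumption.chiSq_le {ρ : S → ℝ} (h : PolicyClassAssumption πref β R πstar P)
    (hρ : ρ ∈ stdSimplex ℝ S) (hpos : ∀ s a, 0 < πref s a) (hβ : 0 < β) (hR : 0 < R)
    {π : S → A → ℝ} (hπ : π ∈ convexHull ℝ (P : Set (S → A → ℝ))) :
    chiSq ρ π πstar ≤ kappa (Real.exp (2 * R / β)) * klReg ρ πstar π := by
  have hπ0 := h.pos_of_mem_convexHull hpos hπ
  refine chiSq_le_kappa_mul_klReg hρ.1 (Real.one_lt_exp_iff.2 (by positivity))
    (h.isPolicy_of_mem_convexHull hπ) (h.isPolicy _ h.realizable) hπ0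
    (h.pos _ h.realizable) fun s a => ?_
  rw [div_le_iff₀ (hπ0 s a)]
  calc πstar s a ≤ πref s a * Real.exp (R / β) := (h.mem_Icc hpos h.realizable s a).2
    _ = Real.exp (2 * R / β) * (πref s a * Real.exp (-(R / β))) := by
        rw [mul_left_comm, ← Real.exp_add]
        congr 2
        ring
    _ ≤ _ := mul_le_mul_of_nonneg_left (h.le_of_mem_convexHull hpos hπ s a) (Real.exp_pos _).le

/-- On the support of `ρ` the reward converted from the optimal policy is a log-ratio and differs
from the true reward by a function of the state. -/
theorem PolicyClassAssumption.exists_reward_eq {ρ : S → ℝ} {r : S → A → ℝ}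
    (h : PolicyClassAssumption πref β R πstar P) (hρ : ρ ∈ stdSimplex ℝ S) (href : IsPolicy πref)
    (hpos : ∀ s a, 0 < πref s a) (hβ : 0 < β) (hr : ∀ s a, r s a ∈ Set.Icc 0 R)
    (hopt : IsOptimalPolicy ρ πref β r πstar) :
    ∃ c c' : S → ℝ, ∀ s, ρ s ≠ 0 → ∀ a,
      r s a = β * Real.log (πstar s a / πref s a) + c s ∧
      rewardOf πref β R πstar s a = β * Real.log (πstar s a / πref s a) + c' s := by
  obtain ⟨c, hc⟩ := hopt.exists_reward_eq hρ href hpos hβ (h.pos _ h.realizable)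
  refine ⟨c, fun s => -⨅ a', β * Real.log (πstar s a' / πref s a'), fun s hs a =>
    ⟨hc s hs a, rewardOf_eq_sub_iInf (fun a a' => ?_) a⟩⟩
  -- The log-ratio oscillates exactly as `r`, hence by at most `R`, so clipping is inactive; the
  -- class bound alone would give `2 R`.
  linarith [hc s hs a, hc s hs a', (hr s a).2, (hr s a').1]

end PolicyClass

variable {S A : Type*} [Fintype S] [Fintype A]

/-- A regret bound and the burn-in condition bound the accumulated `χ²`-divergence. -/
theorem kappa_div_mul_le_of_burnIn {β R cplx cOL ℓ q T x : ℝ} (hβ : 0 < β) (hR : 0 < R)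
    (hcOL : 0 < cOL) (hℓ : 0 ≤ ℓ) (hT : 0 ≤ T)
    (hburn : cOL ^ 2 * burnIn β R cplx * ℓ ^ (2 * q) ≤ T)
    (hx : x ≤ cOL * cplx * √T * ℓ ^ q) : kappa (Real.exp (2 * R / β)) / β * x ≤ T := by
  have hκ := kappa_pos (Real.one_lt_exp_iff.2 (by positivity : 0 < 2 * R / β))
  rw [burnIn] at hburn
  set k := kappa (Real.exp (2 * R / β))
  have hℓ2 : ℓ ^ (2 * q) = (ℓ ^ q) ^ 2 := by
    rw [mul_comm, Real.rpow_mul hℓ]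
    norm_cast
  -- The square of this inequality is the burn-in condition.
  have h1 : k / β * (cOL * cplx * ℓ ^ q) ≤ √T := by
    refine Real.le_sqrt_of_sq_le (le_trans (le_of_eq ?_) hburn)
    rw [hℓ2]
    field_simp
  calc k / β * x ≤ k / β * (cOL * cplx * √T * ℓ ^ q) := by gcongr
    _ = k / β * (cOL * cplx * ℓ ^ q) * √T := by ring
    _ ≤ √T * √T := by gcongr
    _ = T := Real.mul_self_sqrt hT

/-- The value gap of RPO on sequential data from a no-regret algorithm, after the burn-in time. -/
theorem value_sub_le_of_noRegret {ρ : S → ℝ} {πref rstar πstar : S → A → ℝ}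
    {β R cplx δ cOL pOL : ℝ} {P : Finset (S → A → ℝ)} {T : ℕ} {Ω : Type*} [MeasurableSpace Ω]
    {μ : Measure Ω} [IsProbabilityMeasure μ] {pol : Fin T → Ω → S → A → ℝ}
    {D : Fin T → Ω → S × A × A × Bool} (hρ : ρ ∈ stdSimplex ℝ S) (href : IsPolicy πref)
    (hpos : ∀ s a, 0 < πref s a) (hβ : 0 < β) (hR : 0 < R)
    (hr : ∀ s a, rstar s a ∈ Set.Icc 0 R) (hopt : IsOptimalPolicy ρ πref β rstar πstar)
    (hP : PolicyClassAssumption πref β R πstar P) (hδ : δ ∈ Set.Ioo (0 : ℝ) 1)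
    (hcOL : 0 < cOL) (hT : 0 < T)
    (hseq : IsSequentialData μ ρ πref rstar pol D)
    (hpol : ∀ᵐ ω ∂μ, ∀ i, pol i ω ∈ convexHull ℝ (P : Set (S → A → ℝ)))
    (hreg : WithFailureProb μ δ (fun ω =>
      ∑ i, (value ρ πref β rstar πstar - value ρ πref β rstar (pol i ω))
        ≤ cOL * cplx * √T * Real.log (P.card * T / δ) ^ pOL))
    (hburn : cOL ^ 2 * burnIn β R cplx * Real.log (P.card * T / δ) ^ (2 * pOL) ≤ T) :
    WithFailureProb μ (2 * δ) (fun ω => ∀ πDstl,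
      IsRPOSolution ρ πref β (rpoWeight R δ P.card T) (convexHull ℝ (P : Set (S → A → ℝ)))
        (rewardClass πref β R P) (fun i => D i ω) πDstl →
      value ρ πref β rstar πstar - value ρ πref β rstar πDstl
        ≤ 12 * Real.exp (2 * R) * √(Real.log (P.card / δ) / T)) := by
  obtain ⟨c, c', hcc⟩ := hP.exists_reward_eq hρ href hpos hβ hr hopt
  set r₀ := rewardOf πref β R πstar
  have hstar0 := hP.pos _ hP.realizable
  have hval : ∀ π, IsPolicy π → value ρ πref β rstar πstar - value ρ πref β rstar π
      = β * klReg ρ πstar π := fun π hπ => by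
    rw [value_eq_sub_klReg hπ hstar0 hpos fun s hs a => (hcc s hs a).1,
      value_eq_sub_klReg hopt.1 hstar0 hpos fun s hs a => (hcc s hs a).1, klReg_self ρ hstar0]
    ring
  have hval₀ : ∀ π, IsPolicy π → value ρ πref β r₀ πstar - value ρ πref β r₀ π
      = β * klReg ρ πstar π := fun π hπ => by
    rw [value_eq_sub_klReg hπ hstar0 hpos fun s hs a => (hcc s hs a).2,
      value_eq_sub_klReg hopt.1 hstar0 hpos fun s hs a => (hcc s hs a).2, klReg_self ρ hstar0]
    ring
  have hseq₀ : IsSequentialData μ ρ πref r₀ pol D := hseq.congr_reward fun s hs a a' => by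
    rw [(hcc s hs a).1, (hcc s hs a').1, (hcc s hs a).2, (hcc s hs a').2]
    ring
  have hcard : 1 ≤ P.card := Finset.card_pos.2 ⟨_, hP.realizable⟩
  have hN : (1 : ℝ) ≤ P.card := by exact_mod_cast hcard
  have hT1 : (1 : ℝ) ≤ T := by exact_mod_cast hT
  have hK1 : 1 < P.card / δ := by rw [lt_div_iff₀ hδ.1]; linarith [hδ.2]
  have hL := Real.log_pos hK1
  have hℓ : 0 ≤ Real.log (P.card * T / δ) := by
    refine Real.log_nonneg ?_
    rw [le_div_iff₀ hδ.1]
    nlinarith [hδ.2]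
  have hpolicy : ∀ᵐ ω ∂μ, ∀ i, IsPolicy (pol i ω) :=
    hpol.mono fun ω h i => hP.isPolicy_of_mem_convexHull (h i)
  set bad : (S → A → ℝ) → Set Ω := fun π =>
    {ω | ¬ (nll (fun i => D i ω) r₀ - nll (fun i => D i ω) (rewardOf πref β R π)
      ≤ 2 / T * Real.log (P.card / δ) - curvature R / T *
        ∑ i, pairMean ρ πref (pol i ω) (gapSq (rewardOf πref β R π) r₀))}
  have hconc : μ (⋃ π ∈ P, bad π) ≤ ENNReal.ofReal δ := by
    refine (measure_biUnion_finset_le P bad).trans ?_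
    -- With `K = |Π| / δ` each reward fails with probability at most `δ / |Π|`.
    calc ∑ π ∈ P, μ (bad π) ≤ ∑ _π ∈ P, ENNReal.ofReal (1 / (P.card / δ)) :=
          Finset.sum_le_sum fun π _ => hseq₀.measure_nll_sub_le hρ href hpolicy
            (rewardOf_mem_Icc πref β hR.le π) (rewardOf_mem_Icc πref β hR.le πstar) hT
            (by linarith)
      _ = ENNReal.ofReal δ := by
          rw [Finset.sum_const, ← ENNReal.ofReal_nsmul, nsmul_eq_mul]
          congr 1
          have := hδ.1.ne'
          field_simp
  unfold WithFailureProb at hreg ⊢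
  rw [two_mul δ, ENNReal.ofReal_add hδ.1.le hδ.1.le]
  -- The budget `2 δ` splits between the regret bound and the concentration event.
  refine le_trans ?_ ((measure_union_le _ _).trans (add_le_add hreg hconc))
  refine measure_mono_ae ?_
  filter_upwards [hpol] with ω hω hfail
  by_contra hgood
  refine hfail fun πDstl hsol => ?_
  have hgood1 := fun h => hgood (Or.inl h)
  have hgood2 := fun h => hgood (Or.inr h)
  have hregω := not_not.1 hgood1
  have hnll : ∀ r ∈ rewardClass πref β R P,
      nll (fun i => D i ω) r₀ - nll (fun i => D i ω) r ≤ 2 / T * Real.log (P.card / δ)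
        - curvature R / T * ∑ i, pairMean ρ πref (pol i ω) (gapSq r r₀) := by
    rintro _ ⟨π, hπ, rfl⟩
    by_contra hneg
    exact hgood2 (Set.mem_biUnion hπ hneg)
  have hpolω := fun i => hP.isPolicy_of_mem_convexHull (hω i)
  have hχ : ∑ i, chiSq ρ (pol i ω) πstar ≤ T := by
    refine le_trans ?_ (kappa_div_mul_le_of_burnIn hβ hR hcOL hℓ (by linarith) hburn hregω)
    rw [Finset.mul_sum]
    refine Finset.sum_le_sum fun i _ => (hP.chiSq_le hρ hpos hβ hR (hω i)).trans_eq ?_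
    rw [hval _ (hpolω i)]
    field_simp
  have hgap := hsol.value_sub_le (P.finite_toSet.image _) hρ href
    (fun π hπ => hP.isPolicy_of_mem_convexHull hπ) (subset_convexHull ℝ _ hP.realizable)
    (Set.mem_image_of_mem _ hP.realizable) hT (rpoWeight_pos hL hT) (curvature_pos R) hpolω
    (fun i => hP.pos_of_mem_convexHull hpos (hω i)) hχ hnll
  have hDstl := hP.isPolicy_of_mem_convexHull hsol.1
  -- Both rewards give the suboptimality `β KL(π ‖ π*)`, so the bound for `r₀` transfers to `r*`.
  rw [hval _ hDstl, ← hval₀ _ hDstl]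
  exact hgap.trans (rpoWeight_bound hR.le hL hT)

end RLHF

/-! ### The corollary with explicit constants -/

theorem mainTheorem6 :
    ∃ C : ℝ, 0 < C ∧ ∃ C' : ℝ, 0 < C' ∧
    ∀ cOL : ℝ, 0 < cOL → ∀ pOL : ℝ, 0 ≤ pOL →
    ∃ c : ℝ, 0 < c ∧ ∃ p : ℝ, 0 ≤ p ∧
    ∀ (S A : Type*) [Fintype S] [Fintype A]
      (ρ : S → ℝ) (πref rstar πstar : S → A → ℝ) (β R cplx δ : ℝ)
      (P : Finset (S → A → ℝ)) (T : ℕ)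
      (Ω : Type*) [MeasurableSpace Ω] (μ : MeasureTheory.Measure Ω)
      [MeasureTheory.IsProbabilityMeasure μ]
      (pol : Fin T → Ω → S → A → ℝ) (D : Fin T → Ω → S × A × A × Bool),
      ρ ∈ stdSimplex ℝ S →
      RLHF.IsPolicy πref → (∀ s a, 0 < πref s a) →
      0 < β → 0 < R → (∀ s a, rstar s a ∈ Set.Icc 0 R) →
      RLHF.IsOptimalPolicy ρ πref β rstar πstar →
      RLHF.PolicyClassAssumption πref β R πstar P →
      δ ∈ Set.Ioo (0 : ℝ) 1 → 0 ≤ cplx → 0 < T →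
      RLHF.IsSequentialData μ ρ πref rstar pol D →
      (∀ᵐ ω ∂μ, ∀ i, pol i ω ∈ convexHull ℝ (P : Set (S → A → ℝ))) →
      -- the no-regret property of the online algorithm, with probability at least `1 - δ`
      RLHF.WithFailureProb μ δ (fun ω =>
        ∑ i, (RLHF.value ρ πref β rstar πstar - RLHF.value ρ πref β rstar (pol i ω))
          ≤ cOL * cplx * √T * Real.log (P.card * T / δ) ^ pOL) →
      -- RPO on the collected data has a solution
      (∀ ω, ∃ π, RLHF.IsRPOSolution ρ πref β (RLHF.rpoWeight R δ P.card T)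
          (convexHull ℝ (P : Set (S → A → ℝ))) (RLHF.rewardClass πref β R P)
          (fun i => D i ω) π) ∧
      -- the value gap of the distilled policy after the burn-in time
      (RLHF.burnInLog c p β R cplx δ P.card ≤ T →
        RLHF.WithFailureProb μ (2 * δ) (fun ω => ∀ πDstl,
          RLHF.IsRPOSolution ρ πref β (RLHF.rpoWeight R δ P.card T)
            (convexHull ℝ (P : Set (S → A → ℝ))) (RLHF.rewardClass πref β R P)
            (fun i => D i ω) πDstl →
          RLHF.value ρ πref β rstar πstar - RLHF.value ρ πref β rstar πDstl
            ≤ C * Real.exp (2 * R) * √(Real.log (P.card / δ) / T))) ∧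
      -- the sample complexity for every `ε` below a threshold
      (∀ ε : ℝ, 0 < ε →
        RLHF.burnInLog c p β R cplx δ P.card * ε ^ 2
          ≤ C' * Real.exp (4 * R) * Real.log (P.card / δ) →
        C' * Real.exp (4 * R) * Real.log (P.card / δ) / ε ^ 2 ≤ T →
        RLHF.WithFailureProb μ (2 * δ) (fun ω => ∀ πDstl,
          RLHF.IsRPOSolution ρ πref β (RLHF.rpoWeight R δ P.card T)
            (convexHull ℝ (P : Set (S → A → ℝ))) (RLHF.rewardClass πref β R P)
            (fun i => D i ω) πDstl →
          RLHF.value ρ πref β rstar πstar - RLHF.value ρ πref β rstar πDstl ≤ ε)) := by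
  -- `12` comes from `rpoWeight_bound`, and `144 = 12²` from solving the gap bound for `T`. The
  -- exponent `p = 2 pOL` appears because the burn-in squares the regret bound.
  refine ⟨12, by norm_num, 144, by norm_num, fun cOL hcOL pOL hpOL => ?_⟩
  obtain ⟨c, hc, hinv⟩ :=
    RLHF.exists_burnIn_inversion (cOL ^ 2) (2 * pOL) (by positivity) (by positivity)
  refine ⟨c, hc, 2 * pOL, by positivity, ?_⟩
  intro S A _ _ ρ πref rstar πstar β R cplx δ P T Ω _ μ _ pol D hρ href hpos hβ hR hr hopt hP hδ
    hcplx hT hseq hpol hreg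
  have hN : (1 : ℝ) ≤ P.card := by
    exact_mod_cast Nat.one_le_iff_ne_zero.2 (Finset.card_pos.2 ⟨_, hP.realizable⟩).ne'
  have hT1 : (1 : ℝ) ≤ T := by exact_mod_cast hT
  have hK1 : 1 < P.card / δ := by rw [lt_div_iff₀ hδ.1]; linarith [hδ.2]
  have hL := Real.log_pos hK1
  have hgap : RLHF.burnInLog c (2 * pOL) β R cplx δ P.card ≤ T → _ := fun hburn =>
    RLHF.value_sub_le_of_noRegret hρ href hpos hβ hR hr hopt hP hδ hcOL hT hseq hpol hreg
      (by
        have hX : 0 ≤ RLHF.burnIn β R cplx := by unfold RLHF.burnIn; positivity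
        rw [RLHF.burnInLog, mul_div_assoc] at hburn
        rw [mul_div_right_comm]
        exact hinv _ _ _ hX hK1.le hT1 hburn)
  refine ⟨fun ω => RLHF.exists_isRPOSolution ρ hpos β _ (P.finite_toSet.isCompact_convexHull ℝ)
    ⟨_, subset_convexHull ℝ _ hP.realizable⟩ (P.finite_toSet.image _)
    (Set.Nonempty.image _ ⟨_, hP.realizable⟩) _, hgap, fun ε hε hthr hTε => ?_⟩
  -- Below the threshold for `ε`, the required sample size already exceeds the burn-in time.
  have hburn : RLHF.burnInLog c (2 * pOL) β R cplx δ P.card ≤ T :=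
    ((le_div_iff₀ (by positivity)).2 hthr).trans hTε
  refine (MeasureTheory.measure_mono ?_).trans (hgap hburn)
  intro ω hω hall
  refine hω fun πDstl hsol => (hall πDstl hsol).trans ?_
  rw [div_le_iff₀ (by positivity)] at hTε
  have hsq : √(Real.log (P.card / δ) / T) ≤ ε / (12 * Real.exp (2 * R)) := by
    refine Real.sqrt_le_iff.2 ⟨by positivity, ?_⟩
    have he : Real.exp (4 * R) = Real.exp (2 * R) ^ 2 := by
      rw [← Real.exp_nat_mul]
      congr 1
      push_cast
      ring
    rw [he] at hTε
    rw [div_pow, div_le_div_iff₀ (by linarith) (by positivity)]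
    linarith
  calc 12 * Real.exp (2 * R) * √(Real.log (P.card / δ) / T)
      ≤ 12 * Real.exp (2 * R) * (ε / (12 * Real.exp (2 * R))) := by gcongr
    _ = ε := by field_simp
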